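/- All graphs are finite. A \emph{block} of a graph is a maximal 2-connected subgraph (one with at least three vertices), or the subgraph formed by a bridge, or the subgraph formed by an isolated vertex. For connected graphs $G,H$ on the same vertex set write $G\sim H$ if they have the same number of blocks of each isomorphism type; for general graphs on the same vertex set write $G\sim H$ if their components can be listed as $G_1,\dots,G_j$ and $H_1,\dots,H_j$ with $V(G_i)=V(H_i)$ and $G_i\sim H_i$ for each $i$. A class $\mathcal A$ of graphs, closed under isomorphism, is \emph{weakly block-stable} if $G\in\mathcal A$ and $H\sim G$ imply $H\in\mathcal A$. The \emph{block forest} $\mathrm{bf}(G)$ of $G$ is the bipartite graph with a node $x_v$ for each vertex $v$ of $G$ and a node $y_B$ for each block $B$ of $G$, where $x_v$ and $y_B$ are adjacent if and only if $v\in B$ (so it is the disjoint union of the block trees of the components of $G$). The \emph{diameter} of a graph is the maximum distance between two vertices in the same component. Let $\mathcal A_n$ be the set of graphs in $\mathcal A$ on the vertex set $\{1,\dots,n\}$; only integers $n$ with $\mathcal A_n\neq\emptyset$ are considered, also in limits $n\to\infty$. Let $R_n$ be uniformly distributed on $\mathcal A_n$. An event holds \emph{whp} if its probability tends to $1$ as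 $n\to\infty$, and $\log$ is the natural logarithm. Theorem. (1) For every weakly block-stable class $\mathcal A$, whp $\mathrm{bf}(R_n)$ has diameter at most $5\sqrt{n\log n}$. (2) For every $\varepsilon>0$ there are a constant $c>0$ and an integer $N$, depending only on $\varepsilon$, such that for every weakly block-stable class $\mathcal A$ and every $n\ge N$ with $\mathcal A_n\neq\emptyset$, $$\mathbb P\big(\mathrm{bf}(R_n)\text{ has diameter at least }\varepsilon n\big)\le e^{-cn}.$$ (3) Let $\mathcal A$ be a weakly block-stable class such that for each $n\ge1$ every graph in $\mathcal A_n$ has at most $k=k(n)$ blocks, where $k(n)\to\infty$ as $n\to\infty$. Then whp $\mathrm{bf}(R_n)$ has diameter at most $5\sqrt{k\log k}$. -/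

import Mathlib

open Filter Topology

noncomputable section

namespace BlockStable

/-- A subgraph is 2-connected: it has at least three vertices, is connected, and stays connected
after the removal of any single vertex. -/
def IsTwoConnected {V : Type*} {G : SimpleGraph V} (H : G.Subgraph) : Prop :=
  3 ≤ H.verts.encard ∧ H.Connected ∧ ∀ v ∈ H.verts, (H.deleteVerts {v}).Connected

/-- A block of `G`: a maximal 2-connected subgraph, or the subgraph formed by a bridge
(with its two end-vertices), or the subgraph formed by an isolated vertex. -/
def IsBlock {V : Type*} {G : SimpleGraph V} (B : G.Subgraph) : Prop :=
  Maximal IsTwoConnected B ∨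
  (∃ (u v : V) (h : G.Adj u v), G.IsBridge s(u, v) ∧ B = G.subgraphOfAdj h) ∨
  (∃ v : V, G.IsIsolated v ∧ B = G.singletonSubgraph v)

/-- The type of blocks of `G`. -/
abbrev Block {V : Type*} (G : SimpleGraph V) : Type _ := {B : G.Subgraph // IsBlock B}

/-- The number of blocks of `G`. -/
def numBlocks {V : Type*} (G : SimpleGraph V) : ℕ := Nat.card (Block G)

/-- The number of blocks of `G` of the kind `K`, that is, isomorphic to `K`. -/
def numBlocksOfKind {V W : Type*} (G : SimpleGraph V) (K : SimpleGraph W) : ℕ :=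
  Nat.card {B : Block G // Nonempty (B.1.coe ≃g K)}

/-- `G` and `H` have the same number of blocks of each kind (up to isomorphism). -/
def SameBlocks {V W : Type*} (G : SimpleGraph V) (H : SimpleGraph W) : Prop :=
  ∀ (m : ℕ) (K : SimpleGraph (Fin m)), numBlocksOfKind G K = numBlocksOfKind H K

/-- The relation `G ∼ H` for graphs on the same vertex set: the components of `G` and of `H` can be
matched so that matched components have the same vertex set and the same number of blocks of each
kind. -/
def Equivalent {V : Type*} (G H : SimpleGraph V) : Prop :=
  ∃ e : G.ConnectedComponent ≃ H.ConnectedComponent, ∀ c : G.ConnectedComponent,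
    (e c).supp = c.supp ∧ SameBlocks c.toSimpleGraph (e c).toSimpleGraph

/-- A class of finite graphs, closed under isomorphism. -/
structure GraphClass where
  /-- membership of a finite graph in the class -/
  Mem : ∀ (V : Type) [Finite V], SimpleGraph V → Prop
  /-- closure under isomorphism -/
  iso_closed : ∀ (V W : Type) [Finite V] [Finite W] (G : SimpleGraph V) (H : SimpleGraph W),
    Nonempty (G ≃g H) → Mem V G → Mem W H

/-- A class is weakly block-stable if `G ∈ A` and `H ∼ G` imply `H ∈ A`. -/
def GraphClass.WeaklyBlockStable (A : GraphClass) : Prop :=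
  ∀ (V : Type) [Finite V] (G H : SimpleGraph V), A.Mem V G → Equivalent H G → A.Mem V H

/-- The set `A_n` of the graphs in `A` on a fixed vertex set of `n` labelled vertices. -/
def GraphClass.on (A : GraphClass) (n : ℕ) : Set (SimpleGraph (Fin n)) :=
  {G | A.Mem (Fin n) G}

/-- The probability that a uniformly random element `R_n` of `A_n` has the property `P`
(used only when `A_n` is nonempty). -/
def GraphClass.prob (A : GraphClass) (n : ℕ) (P : SimpleGraph (Fin n) → Prop) : ℝ :=
  ({G ∈ A.on n | P G}.ncard : ℝ) / ((A.on n).ncard : ℝ)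

/-- `n → ∞` through the integers `n` for which `A_n` is nonempty. -/
def GraphClass.sizes (A : GraphClass) : Filter ℕ :=
  atTop ⊓ 𝓟 {n | (A.on n).Nonempty}

/-- With high probability `R_n` has the property `P n`. -/
def GraphClass.Whp (A : GraphClass) (P : ∀ n : ℕ, SimpleGraph (Fin n) → Prop) : Prop :=
  Tendsto (fun n => A.prob n (P n)) A.sizes (𝓝 1)

/-- The block forest of `G`: a node `Sum.inl v` for each vertex `v`, a node `Sum.inr B` for each
block `B`, and `v`, `B` are adjacent if and only if `v ∈ B`. As each block lies in a single
component, this is the disjoint union of the block trees of the components. -/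
def blockForest {V : Type*} (G : SimpleGraph V) : SimpleGraph (V ⊕ Block G) where
  Adj
    | Sum.inl v, Sum.inr B => v ∈ B.1.verts
    | Sum.inr B, Sum.inl v => v ∈ B.1.verts
    | _, _ => False
  symm := ⟨by rintro (v | B) (w | C) h <;> exact h⟩
  loopless := ⟨by rintro (v | B) h <;> exact h⟩

/-- The diameter of a finite graph: the maximum distance between two vertices in the same
component (and `0` if there are no vertices). -/
def diameter {V : Type*} (F : SimpleGraph V) : ℕ :=
  sSup {d | ∃ u v : V, F.Reachable u v ∧ F.dist u v = d}

end BlockStable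

end

/-!
Fix a connected graph and one of its blocks as the root. Every other block has a unique vertex closest
to the root block, its *parent vertex*; removing the parent vertices from the other blocks gives a
partition of the non-root vertices into *parts* (`Decomp`, `exists_decomp`). Moving each part to
another parent vertex, along any map from parts to vertices that creates no cycles, gives a connected
graph with the same blocks up to isomorphism (`Decomp.sameBlocks_reattach`), and different maps give
different graphs (`Decomp.reattach_injective`). So, among connected graphs with given numbers of blocks,
the pairs of a graph and a root block split into families, each indexed by the acyclic parent maps of
a fixed partition (`ReattachRel`).

Such a family is understood completely. If `s` of the `n` vertices lie in the root block, a uniformly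
random map from parts to vertices is acyclic with probability `s / n`, whatever the parts are
(`card_acyclic`): reveal one parent, merge the part with the part of its parent, and use induction.
Since merging leaves `s` and `n` unchanged as long as the root is not met, the same revealing along
the way from a given part to the root shows that, for a random acyclic map, this way has more than
`t` steps with the probability that `t` independent uniform vertices lie in distinct parts
different from the given one (`card_deep_le`). By the birthday bound this is at most
`e t exp (-t ^ 2 / (2 K))` when there are at most `K` blocks (`factorial_mul_elemSymm_le`).

Summing over the pairs of blocks in a common component gives a factor `K ^ 2`
(`sum_far_le`, `card_far_le`), and if every two blocks of a component are joined by a chain of `t`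
blocks, the block forest has diameter at most `2 t + 2` (`diameter_blockForest_le`). Taking `t` just
below `(5 / 2) √(K log K)` makes the total of order `K ^ (-1/8)`, and `t` about `ε n / 2` makes it
exponentially small. A graph has at most as many blocks as vertices (`numBlocks_le_card`), so `K = n`
is always allowed.
-/

noncomputable section

namespace BlockStable

/-! ### Connectivity inside a set of vertices -/

/-- The relation `r` connects any two points of `U` through points of `U`. -/
def ConnectsOn {V : Type*} (r : V → V → Prop) (U : Set V) : Prop :=
  ∀ a ∈ U, ∀ b ∈ U, Relation.ReflTransGen (fun x y => r x y ∧ x ∈ U ∧ y ∈ U) a b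

lemma ConnectsOn.mono {V : Type*} {r r' : V → V → Prop} {U : Set V} (h : ConnectsOn r U)
    (hr : ∀ x ∈ U, ∀ y ∈ U, r x y → r' x y) : ConnectsOn r' U := fun a ha b hb =>
  (h a ha b hb).lift id fun x y hxy => ⟨hr x hxy.2.1 y hxy.2.2 hxy.1, hxy.2⟩

lemma ConnectsOn.image {V W : Type*} {r : V → V → Prop} {s : W → W → Prop} {U : Set V}
    (h : ConnectsOn r U) (φ : V → W) (hφ : ∀ x ∈ U, ∀ y ∈ U, r x y → s (φ x) (φ y)) :
    ConnectsOn s (φ '' U) := by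
  rintro _ ⟨a, ha, rfl⟩ _ ⟨b, hb, rfl⟩
  exact (h a ha b hb).lift φ fun x y hxy =>
    ⟨hφ x hxy.2.1 y hxy.2.2 hxy.1, ⟨x, hxy.2.1, rfl⟩, ⟨y, hxy.2.2, rfl⟩⟩

lemma ConnectsOn.preimage_val {V : Type*} {r : V → V → Prop} {C : Set V} {U : Set C}
    (h : ConnectsOn r (Subtype.val '' U)) :
    ConnectsOn (fun x y : C => r x y) U := by
  intro a ha b hb
  have key : ∀ z, Relation.ReflTransGen
      (fun x y => r x y ∧ x ∈ Subtype.val '' U ∧ y ∈ Subtype.val '' U) (a : V) z →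
      ∀ hz : z ∈ C, Relation.ReflTransGen (fun x y : C => r x y ∧ x ∈ U ∧ y ∈ U) a ⟨z, hz⟩ := by
    intro z hz
    induction hz with
    | refl => intro _; exact .refl
    | tail _ h2 ih =>
      intro hz
      obtain ⟨h3, ⟨y, hy, rfl⟩, ⟨w, hw, rfl⟩⟩ := h2
      exact (ih y.2).tail ⟨h3, hy, hw⟩
  exact key b (h a ⟨a, ha, rfl⟩ b ⟨b, hb, rfl⟩) b.2

lemma connectsOn_of_center {V : Type*} {r : V → V → Prop} (hr : ∀ x y, r x y → r y x) {U : Set V}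
    (c : V) (h : ∀ a ∈ U, Relation.ReflTransGen (fun x y => r x y ∧ x ∈ U ∧ y ∈ U) a c) :
    ConnectsOn r U := by
  intro a ha b hb
  have hs : Std.Symm (fun x y => r x y ∧ x ∈ U ∧ y ∈ U) :=
    ⟨fun x y h => ⟨hr _ _ h.1, h.2.2, h.2.1⟩⟩
  exact (h a ha).trans (Relation.ReflTransGen.stdSymm.symm _ _ (h b hb))

lemma reflTransGen_mono_set {V : Type*} {r : V → V → Prop} {U U' : Set V} (h : U ⊆ U') {a b : V}
    (hab : Relation.ReflTransGen (fun x y => r x y ∧ x ∈ U ∧ y ∈ U) a b) :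
    Relation.ReflTransGen (fun x y => r x y ∧ x ∈ U' ∧ y ∈ U') a b :=
  hab.lift id fun _ _ h' => ⟨h'.1, h h'.2.1, h h'.2.2⟩

lemma connectsOn_of_subsingleton {V : Type*} {r : V → V → Prop} {U : Set V}
    (h : U.Subsingleton) : ConnectsOn r U := fun a ha b hb => by
  rw [h ha hb]

/-- A walk inside `U` connects its ends inside `U`. -/
lemma reflTransGen_of_walk {V : Type*} {G : SimpleGraph V} {U : Set V} {a b : V} (p : G.Walk a b)
    (hp : ∀ z ∈ p.support, z ∈ U) :
    Relation.ReflTransGen (fun x y => G.Adj x y ∧ x ∈ U ∧ y ∈ U) a b := by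
  induction p with
  | nil => exact .refl
  | @cons u v w h q ih =>
    refine .head ⟨h, hp _ (by simp), hp _ (by simp)⟩ (ih fun z hz => hp z (by simp [hz]))

/-- Points that are connected inside `U` are joined by a path inside `U`. -/
lemma exists_path_of_reflTransGen {V : Type*} {G : SimpleGraph V} {U : Set V} {a b : V}
    (ha : a ∈ U) (h : Relation.ReflTransGen (fun x y => G.Adj x y ∧ x ∈ U ∧ y ∈ U) a b) :
    ∃ p : G.Walk a b, p.IsPath ∧ ∀ z ∈ p.support, z ∈ U := by
  classical
  suffices ∃ p : G.Walk a b, ∀ z ∈ p.support, z ∈ U by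
    obtain ⟨p, hp⟩ := this
    exact ⟨p.bypass, p.bypass_isPath, fun z hz => hp z (p.support_bypass_subset_support hz)⟩
  induction h using Relation.ReflTransGen.head_induction_on with
  | refl => exact ⟨.nil, by simpa using ha⟩
  | @head x y hxy _ ih =>
    obtain ⟨p, hp⟩ := ih hxy.2.2
    exact ⟨.cons hxy.1 p, by simpa using ⟨ha, hp⟩⟩

/-! ### Nonseparable vertex sets and blocks -/

/-- A nonempty set of vertices that induces a connected graph without cut vertex. -/
def Nonseparable {V : Type*} (G : SimpleGraph V) (U : Set V) : Prop :=
  U.Nonempty ∧ ConnectsOn G.Adj U ∧ ∀ v, ConnectsOn G.Adj (U \ {v})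

/-- The vertex sets of the blocks of `G`: the maximal nonseparable sets. -/
def IsBlockSet {V : Type*} (G : SimpleGraph V) (U : Set V) : Prop := Maximal (Nonseparable G) U

lemma nonseparable_singleton {V : Type*} (G : SimpleGraph V) (v : V) : Nonseparable G {v} :=
  ⟨⟨v, rfl⟩, connectsOn_of_subsingleton (by simp),
    fun _ => connectsOn_of_subsingleton (Set.subsingleton_singleton.anti Set.sdiff_subset)⟩

lemma nonseparable_pair {V : Type*} {G : SimpleGraph V} {u v : V} (h : G.Adj u v) :
    Nonseparable G {u, v} := by
  refine ⟨⟨u, by simp⟩, ?_, fun w => ?_⟩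
  · refine connectsOn_of_center (fun _ _ h => h.symm) u fun a ha => ?_
    rcases ha with rfl | rfl
    · exact .refl
    · exact .single ⟨h.symm, by simp, by simp⟩
  · by_cases hwu : w = u
    · exact connectsOn_of_subsingleton (by rintro x ⟨(rfl | rfl), hx⟩ y ⟨(rfl | rfl), hy⟩ <;> simp_all)
    by_cases hwv : w = v
    · exact connectsOn_of_subsingleton (by rintro x ⟨(rfl | rfl), hx⟩ y ⟨(rfl | rfl), hy⟩ <;> simp_all)
    refine connectsOn_of_center (fun _ _ h => h.symm) u fun a ha => ?_
    rcases ha with ⟨rfl | rfl, ha⟩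
    · exact .refl
    · exact .single ⟨h.symm, ⟨by simp, Ne.symm hwv⟩, ⟨by simp, Ne.symm hwu⟩⟩

/-- Attaching a path with distinct ends in a nonseparable set gives a nonseparable set. -/
lemma Nonseparable.union_path {V : Type*} {G : SimpleGraph V} {U : Set V} (hU : Nonseparable G U)
    {a b : V} (ha : a ∈ U) (hb : b ∈ U) (hab : a ≠ b) (p : G.Walk a b) (hp : p.IsPath) :
    Nonseparable G (U ∪ {z | z ∈ p.support}) := by
  classical
  have hsymm : ∀ x y, G.Adj x y → G.Adj y x := fun _ _ h => h.symm
  have hdel : ∀ x, ConnectsOn G.Adj ((U ∪ {z | z ∈ p.support}) \ {x}) := by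
    intro x
    obtain ⟨c, hc, hcx⟩ : ∃ c ∈ U, c ≠ x := by
      by_cases h : a = x
      · exact ⟨b, hb, fun h' => hab (h.trans h'.symm)⟩
      · exact ⟨a, ha, h⟩
    have hUc : ∀ z ∈ U, z ≠ x → Relation.ReflTransGen (fun u v => G.Adj u v ∧
        u ∈ (U ∪ {z | z ∈ p.support}) \ {x} ∧ v ∈ (U ∪ {z | z ∈ p.support}) \ {x}) z c :=
      fun z hz hzx => reflTransGen_mono_set (Set.sdiff_subset_sdiff_left Set.subset_union_left)
        (hU.2.2 x z ⟨hz, hzx⟩ c ⟨hc, hcx⟩)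
    refine connectsOn_of_center hsymm c ?_
    rintro z ⟨hz | hz, hzx⟩
    · exact hUc z hz hzx
    -- one of the two pieces of the path at `z` avoids `x`
    obtain ⟨q, r, hq, hr, rfl⟩ := hp.mem_support_iff_exists_append.1 hz
    have hnd := hp.support_nodup
    rw [SimpleGraph.Walk.support_append] at hnd
    by_cases hxq : x ∈ q.support
    · have hxr : x ∉ r.support := by
        intro hxr
        rw [← SimpleGraph.Walk.cons_tail_support, List.mem_cons] at hxr
        rcases hxr with rfl | hxr
        · exact hzx rfl
        · exact (List.nodup_append.1 hnd).2.2 x hxq x hxr rfl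
      have hbx : b ≠ x := by rintro rfl; exact hxr r.end_mem_support
      refine Relation.ReflTransGen.trans (reflTransGen_of_walk r fun w hw => ?_) (hUc b hb hbx)
      exact ⟨Or.inr (by simp [hw]), by rintro rfl; exact hxr hw⟩
    · have hax : a ≠ x := by rintro rfl; exact hxq q.start_mem_support
      refine Relation.ReflTransGen.trans (reflTransGen_of_walk q.reverse fun w hw => ?_)
        (hUc a ha hax)
      rw [SimpleGraph.Walk.support_reverse, List.mem_reverse] at hw
      exact ⟨Or.inr (by simp [hw]), by rintro rfl; exact hxq hw⟩
  refine ⟨⟨a, Or.inl ha⟩, ?_, hdel⟩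
  refine connectsOn_of_center hsymm a ?_
  rintro z (hz | hz)
  · exact reflTransGen_mono_set Set.subset_union_left (hU.2.1 z hz a ha)
  · obtain ⟨q, r, hq, hr, rfl⟩ := hp.mem_support_iff_exists_append.1 hz
    exact reflTransGen_of_walk q.reverse fun w hw => Or.inr (by
      rw [SimpleGraph.Walk.support_reverse, List.mem_reverse] at hw; simp [hw])

lemma IsBlockSet.nonseparable {V : Type*} {G : SimpleGraph V} {U : Set V} (h : IsBlockSet G U) :
    Nonseparable G U := h.1

lemma exists_isBlockSet_superset {V : Type*} [Finite V] {G : SimpleGraph V} {U : Set V}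
    (h : Nonseparable G U) : ∃ B, IsBlockSet G B ∧ U ⊆ B := by
  obtain ⟨B, hB, hm⟩ := Finite.exists_le_maximal h
  exact ⟨B, hm, hB⟩

lemma IsBlockSet.eq_of_subset {V : Type*} {G : SimpleGraph V} {U U' : Set V} (h : IsBlockSet G U)
    (h' : Nonseparable G U') (hs : U ⊆ U') : U = U' :=
  Set.Subset.antisymm hs (h.2 h' hs)

/-- A path with both ends in a block stays in the block. -/
lemma IsBlockSet.path_subset {V : Type*} {G : SimpleGraph V} {U : Set V} (hU : IsBlockSet G U)
    {a b : V} (ha : a ∈ U) (hb : b ∈ U) (p : G.Walk a b) (hp : p.IsPath) :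
    ∀ z ∈ p.support, z ∈ U := by
  intro z hz
  by_cases hab : a = b
  · subst hab
    rw [SimpleGraph.Walk.nil_iff_support_eq.1 (SimpleGraph.Walk.isPath_iff_nil.1 hp),
      List.mem_singleton] at hz
    exact hz ▸ ha
  · exact hU.2 (hU.1.union_path ha hb hab p hp) Set.subset_union_left (Or.inr hz)

lemma IsBlockSet.eq_singleton {V : Type*} {G : SimpleGraph V} {v : V} (h : IsBlockSet G {v}) :
    G.IsIsolated v := by
  intro w hw
  have := h.2 (nonseparable_pair hw) (by simp) (Set.mem_insert_of_mem v rfl)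
  exact hw.ne (Set.mem_singleton_iff.1 this).symm

/-! ### Blocks as subgraphs and blocks as vertex sets -/

lemma subgraph_connected_iff {V : Type*} {G : SimpleGraph V} (B : G.Subgraph) :
    B.Connected ↔ B.verts.Nonempty ∧ ConnectsOn B.Adj B.verts := by
  rw [SimpleGraph.Subgraph.connected_iff, and_comm]
  refine and_congr_right fun _ => ?_
  rw [SimpleGraph.Subgraph.preconnected_iff]
  constructor
  · intro h a ha b hb
    have := (SimpleGraph.reachable_iff_reflTransGen _ _).1 (h ⟨a, ha⟩ ⟨b, hb⟩)
    exact this.lift Subtype.val fun x y hxy => ⟨hxy, x.2, y.2⟩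
  · intro h a b
    rw [SimpleGraph.reachable_iff_reflTransGen]
    have h' : ConnectsOn B.Adj (Subtype.val '' (Set.univ : Set B.verts)) := by simpa using h
    exact (h'.preimage_val a trivial b trivial).lift id fun x y hxy => hxy.1

lemma IsTwoConnected.nonseparable {V : Type*} {G : SimpleGraph V} {B : G.Subgraph}
    (h : IsTwoConnected B) : Nonseparable G B.verts := by
  obtain ⟨_, h2, h3⟩ := h
  rw [subgraph_connected_iff] at h2
  refine ⟨h2.1, h2.2.mono fun _ _ _ _ h => h.adj_sub, fun v => ?_⟩
  by_cases hv : v ∈ B.verts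
  · have := ((subgraph_connected_iff _).1 (h3 v hv)).2
    refine ConnectsOn.mono (U := B.verts \ {v}) this fun x _ y _ hxy => ?_
    exact (SimpleGraph.Subgraph.deleteVerts_adj.1 hxy).2.2.2.2.adj_sub
  · rw [Set.sdiff_singleton_eq_self hv]
    exact h2.2.mono fun _ _ _ _ h => h.adj_sub

lemma Nonseparable.isTwoConnected {V : Type*} {G : SimpleGraph V} {U : Set V}
    (h : Nonseparable G U) (h3 : 3 ≤ U.encard) :
    IsTwoConnected ((⊤ : G.Subgraph).induce U) := by
  refine ⟨h3, (subgraph_connected_iff _).2 ⟨h.1, h.2.1.mono fun x hx y hy hxy => ⟨hx, hy, hxy⟩⟩,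
    fun v hv => (subgraph_connected_iff _).2 ⟨?_, ?_⟩⟩
  · change (U \ {v}).Nonempty
    rw [← Set.encard_pos]
    have := Set.encard_sdiff_singleton_add_one (s := U) hv
    by_contra h0
    simp only [not_lt, nonpos_iff_eq_zero] at h0
    rw [h0] at this
    rw [← this] at h3
    exact absurd h3 (by decide)
  · refine ConnectsOn.mono (U := U \ {v}) (h.2.2 v) fun x hx y hy hxy => ?_
    exact SimpleGraph.Subgraph.deleteVerts_adj.2 ⟨hx.1, hx.2, hy.1, hy.2, hx.1, hy.1, hxy⟩

lemma adj_of_nonseparable_pair {V : Type*} {G : SimpleGraph V} {u v : V} (huv : u ≠ v)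
    (h : Nonseparable G {u, v}) : G.Adj u v := by
  have h2 := h.2.1 u (by simp) v (by simp)
  rcases Relation.ReflTransGen.cases_head h2 with h3 | ⟨c, ⟨hc, _, hc'⟩, _⟩
  · exact absurd h3 huv
  · rcases hc' with rfl | rfl
    · exact absurd hc (G.loopless.irrefl _)
    · exact hc

lemma isBlockSet_pair_iff_isBridge {V : Type*} {G : SimpleGraph V} {u v : V} (h : G.Adj u v) :
    IsBlockSet G {u, v} ↔ G.IsBridge s(u, v) := by
  rw [SimpleGraph.isBridge_iff_forall_walk_mem_edges]
  classical
  constructor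
  · intro hB p
    have hs := hB.path_subset (by simp) (by simp) p.bypass p.bypass_isPath
    have : ∀ {a b : V} (q : G.Walk a b), a ≠ b → (∀ z ∈ q.support, z = a ∨ z = b) →
        q.IsPath → s(a, b) ∈ q.edges := by
      intro a b q hab hq hqp
      cases q with
      | nil => exact absurd rfl hab
      | @cons _ c _ hac r =>
        rcases hq c (by simp) with rfl | rfl
        · exact absurd hac (G.loopless.irrefl _)
        · simp
    exact p.edges_bypass_subset_edges (this p.bypass h.ne (by simpa using hs) p.bypass_isPath)
  · intro hb
    refine ⟨nonseparable_pair h, fun U hU hs w hw => ?_⟩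
    by_contra hne
    simp only [Set.mem_insert_iff, Set.mem_singleton_iff, not_or] at hne
    have hu : u ∈ U := hs (by simp)
    have hv : v ∈ U := hs (by simp)
    obtain ⟨p, -, hp⟩ := exists_path_of_reflTransGen (U := U \ {v}) (a := u) (b := w) ⟨hu, h.ne⟩
      (hU.2.2 v u ⟨hu, h.ne⟩ w ⟨hw, hne.2⟩)
    obtain ⟨q, -, hq⟩ := exists_path_of_reflTransGen (U := U \ {u}) (a := w) (b := v) ⟨hw, hne.1⟩
      (hU.2.2 u w ⟨hw, hne.1⟩ v ⟨hv, h.ne'⟩)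
    have := hb (p.append q)
    rw [SimpleGraph.Walk.edges_append, List.mem_append] at this
    rcases this with h1 | h1
    · exact (hp v (SimpleGraph.Walk.snd_mem_support_of_mem_edges p h1)).2 rfl
    · exact (hq u (SimpleGraph.Walk.fst_mem_support_of_mem_edges q h1)).2 rfl

lemma IsBlock.isBlockSet {V : Type*} {G : SimpleGraph V} {B : G.Subgraph} (h : IsBlock B) :
    IsBlockSet G B.verts ∧ B = (⊤ : G.Subgraph).induce B.verts := by
  rcases h with h | ⟨u, v, h, hb, rfl⟩ | ⟨v, hv, rfl⟩
  · have hns := h.1.nonseparable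
    have hle : ∀ {U : Set V}, B.verts ⊆ U → B ≤ (⊤ : G.Subgraph).induce U := fun hU =>
      ⟨hU, fun x y hxy => ⟨hU hxy.fst_mem, hU hxy.snd_mem, hxy.adj_sub⟩⟩
    refine ⟨⟨hns, fun U hU hs => ?_⟩, ?_⟩
    · exact (h.2 (hU.isTwoConnected (h.1.1.trans (Set.encard_le_encard hs))) (hle hs)).1
    · exact le_antisymm (hle subset_rfl) (h.2 (hns.isTwoConnected h.1.1) (hle subset_rfl))
  · refine ⟨(isBlockSet_pair_iff_isBridge h).2 hb, ?_⟩
    ext x y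
    · simp
    · simp only [SimpleGraph.subgraphOfAdj_adj, SimpleGraph.Subgraph.induce_adj,
        SimpleGraph.subgraphOfAdj_verts, SimpleGraph.Subgraph.top_adj, Sym2.eq_iff,
        Set.mem_insert_iff, Set.mem_singleton_iff]
      constructor
      · rintro (⟨rfl, rfl⟩ | ⟨rfl, rfl⟩)
        · exact ⟨Or.inl rfl, Or.inr rfl, h⟩
        · exact ⟨Or.inr rfl, Or.inl rfl, h.symm⟩
      · rintro ⟨rfl | rfl, rfl | rfl, h'⟩
        · exact absurd h' (G.loopless.irrefl _)
        · exact Or.inl ⟨rfl, rfl⟩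
        · exact Or.inr ⟨rfl, rfl⟩
        · exact absurd h' (G.loopless.irrefl _)
  · refine ⟨⟨nonseparable_singleton G v, fun U hU hs w hw => ?_⟩, ?_⟩
    · by_contra hne
      have hvU : v ∈ U := hs rfl
      rcases Relation.ReflTransGen.cases_head (hU.2.1 v hvU w hw) with h3 | ⟨c, ⟨hc, _⟩, _⟩
      · exact hne h3.symm
      · exact hv c hc
    · ext x y
      · simp
      · simp only [SimpleGraph.singletonSubgraph_adj, SimpleGraph.Subgraph.induce_adj,
          SimpleGraph.singletonSubgraph_verts, SimpleGraph.Subgraph.top_adj,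
          Set.mem_singleton_iff]
        constructor
        · intro h; exact h.elim
        · rintro ⟨rfl, rfl, h⟩
          exact (G.loopless.irrefl _ h).elim

lemma IsBlockSet.isBlock {V : Type*} {G : SimpleGraph V} {U : Set V} (h : IsBlockSet G U) :
    IsBlock ((⊤ : G.Subgraph).induce U) := by
  by_cases h3 : 3 ≤ U.encard
  · refine Or.inl ⟨h.1.isTwoConnected h3, fun B hB hle => ?_⟩
    have hv : U = B.verts := h.eq_of_subset hB.nonseparable hle.1
    exact ⟨hv.symm.subset, fun x y hxy =>
      ⟨hv ▸ hxy.fst_mem, hv ▸ hxy.snd_mem, hxy.adj_sub⟩⟩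
  have h2 : U.encard ≤ 2 := by
    rw [not_le] at h3
    exact Order.le_of_lt_add_one h3
  rcases eq_or_lt_of_le h2 with h2 | h1
  · obtain ⟨u, v, huv, rfl⟩ := Set.encard_eq_two.1 h2
    have hadj := adj_of_nonseparable_pair huv h.1
    have hb := (isBlockSet_pair_iff_isBridge hadj).1 h
    have := (IsBlock.isBlockSet (Or.inr (Or.inl ⟨u, v, hadj, hb, rfl⟩) :
      IsBlock (G.subgraphOfAdj hadj))).2
    exact Or.inr (Or.inl ⟨u, v, hadj, hb, this.symm⟩)
  · have h1 : U.encard ≤ 1 := Order.le_of_lt_add_one h1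
    obtain ⟨v, hv⟩ := h.1.1
    obtain rfl : U = {v} := by
      ext w; constructor
      · intro hw; exact Set.encard_le_one_iff.1 h1 w v hw hv
      · rintro rfl; exact hv
    have := (IsBlock.isBlockSet (Or.inr (Or.inr ⟨v, h.eq_singleton, rfl⟩) :
      IsBlock (G.singletonSubgraph v))).2
    exact Or.inr (Or.inr ⟨v, h.eq_singleton, this.symm⟩)

/-- The vertex sets of the blocks of `G`, as a type. -/
abbrev BlockSet {V : Type*} (G : SimpleGraph V) : Type _ := {U : Set V // IsBlockSet G U}

/-- A block is determined by its vertex set, and is the graph induced on it. -/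
def blockEquiv {V : Type*} (G : SimpleGraph V) : Block G ≃ BlockSet G where
  toFun B := ⟨B.1.verts, B.2.isBlockSet.1⟩
  invFun U := ⟨(⊤ : G.Subgraph).induce U.1, U.2.isBlock⟩
  left_inv B := Subtype.ext B.2.isBlockSet.2.symm
  right_inv _ := rfl

/-- The graph of a block is the graph induced on its vertex set. -/
def blockIso {V : Type*} {G : SimpleGraph V} (B : Block G) :
    B.1.coe ≃g G.induce (blockEquiv G B).1 where
  toEquiv := Equiv.refl _
  map_rel_iff' := by
    intro a b
    have h := B.2.isBlockSet.2
    constructor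
    · intro hab
      have h' : ((⊤ : G.Subgraph).induce B.1.verts).Adj a b := ⟨a.2, b.2, hab⟩
      exact h.symm.le.2 h'
    · intro hab
      exact SimpleGraph.Subgraph.Adj.adj_sub (H := B.1) hab

lemma numBlocks_eq {V : Type*} (G : SimpleGraph V) : numBlocks G = Nat.card (BlockSet G) :=
  Nat.card_congr (blockEquiv G)

/-- Graphs have the same blocks as soon as their block sets can be matched so that matched sets
induce isomorphic graphs. -/
lemma sameBlocks_of_equiv {V W : Type*} {G : SimpleGraph V} {H : SimpleGraph W}
    (e : BlockSet G ≃ BlockSet H)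
    (he : ∀ U, Nonempty (G.induce U.1 ≃g H.induce (e U).1)) : SameBlocks G H := by
  intro m K
  refine Nat.card_congr (Equiv.subtypeEquiv
    ((blockEquiv G).trans (e.trans (blockEquiv H).symm)) fun B => ?_)
  obtain ⟨i⟩ := he (blockEquiv G B)
  set B' := ((blockEquiv G).trans (e.trans (blockEquiv H).symm)) B with hB'
  have hB2 : blockEquiv H B' = e (blockEquiv G B) := by simp [hB']
  have j := blockIso B'
  rw [hB2] at j
  have k : B.1.coe ≃g B'.1.coe := ((blockIso B).trans i).trans j.symm
  exact ⟨fun ⟨l⟩ => ⟨k.symm.trans l⟩, fun ⟨l⟩ => ⟨k.trans l⟩⟩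

/-! ### Rooted block decompositions: existence -/

/-- For an owner map `o`, which assigns to each vertex a part or the root (`none`), and a map `f`
that assigns to each part its parent vertex: following parents from part to part never runs in a
cycle, as witnessed by a rank. -/
def Acyclic {W ι : Type*} (o : W → Option ι) (f : ι → W) : Prop :=
  ∃ r : ι → ℕ, ∀ i j, o (f i) = some j → r j < r i

/-- A rooted block decomposition of `H`. The vertices `v` with `o v = none` form the root block; the
other vertices are divided into nonempty parts, and the part `i` together with its parent vertex
`f i` forms a block. -/
structure Decomp {W ι : Type*} (H : SimpleGraph W) (o : W → Option ι) (f : ι → W) : Prop where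
  acyclic : Acyclic o f
  adj : ∀ u v, H.Adj u v → o u = o v ∨ (∃ i, o u = some i ∧ v = f i) ∨ (∃ i, o v = some i ∧ u = f i)
  part_nonempty : ∀ i, ∃ v, o v = some i
  root : Nonseparable H {v | o v = none}
  root_nontrivial : Nonempty ι → {v | o v = none}.Nontrivial
  block : ∀ i, Nonseparable H (insert (f i) {v | o v = some i})

/-- All paths between vertices of `S` stay in `S`. -/
def PathConvex {W : Type*} (H : SimpleGraph W) (S : Set W) : Prop :=
  ∀ a ∈ S, ∀ b ∈ S, ∀ p : H.Walk a b, p.IsPath → ∀ z ∈ p.support, z ∈ S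

lemma IsBlockSet.pathConvex {W : Type*} {H : SimpleGraph W} {B : Set W} (h : IsBlockSet H B) :
    PathConvex H B := fun _ ha _ hb p hp => h.path_subset ha hb p hp

/-- An edge leaving a path-convex set determines a block that meets the set in one vertex only. -/
lemma PathConvex.inter_block {W : Type*} {H : SimpleGraph W} {S B : Set W} (hS : PathConvex H S)
    (hB : IsBlockSet H B) {a x : W} (ha : a ∈ S) (hx : x ∉ S)
    (hxB : x ∈ B) (hax : H.Adj a x) {b : W} (hb : b ∈ S) (hbB : b ∈ B) : b = a := by
  by_contra hne
  obtain ⟨p, hp, hps⟩ := exists_path_of_reflTransGen (U := B \ {a}) (a := x) (b := b)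
    ⟨hxB, hax.ne'⟩ (hB.1.2.2 a x ⟨hxB, hax.ne'⟩ b ⟨hbB, hne⟩)
  refine hx (hS a ha b hb (.cons hax p) ?_ x (by simp))
  rw [SimpleGraph.Walk.cons_isPath_iff]
  exact ⟨hp, fun h => (hps a h).2 rfl⟩

/-- The initial piece of a path, up to its first vertex in `B`. -/
lemma exists_path_to_first {W : Type*} {H : SimpleGraph W} {B : Set W} {y z : W}
    (p : H.Walk y z) (hp : p.IsPath) (hy : y ∉ B) (hz : z ∈ B) :
    ∃ z' ∈ B, ∃ q : H.Walk y z', q.IsPath ∧ (∀ w ∈ q.support, w ∈ p.support) ∧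
      ∀ w ∈ q.support, w ∈ B → w = z' := by
  induction p with
  | nil => exact absurd hz hy
  | @cons u v w h p ih =>
    rw [SimpleGraph.Walk.cons_isPath_iff] at hp
    by_cases hv : v ∈ B
    · refine ⟨v, hv, .cons h .nil, ?_, ?_, ?_⟩
      · rw [SimpleGraph.Walk.cons_isPath_iff]
        exact ⟨.nil, by simpa using h.ne⟩
      · intro w hw
        simp only [SimpleGraph.Walk.support_cons, SimpleGraph.Walk.support_nil, List.mem_cons,
          List.not_mem_nil, or_false] at hw ⊢
        rcases hw with rfl | rfl
        · exact Or.inl rfl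
        · exact Or.inr p.start_mem_support
      · intro w hw hwB
        simp only [SimpleGraph.Walk.support_cons, SimpleGraph.Walk.support_nil, List.mem_cons,
          List.not_mem_nil, or_false] at hw
        rcases hw with rfl | rfl
        · exact absurd hwB hy
        · rfl
    · obtain ⟨z', hz', q, hq, hqp, hqB⟩ := ih hp.1 hv hz
      refine ⟨z', hz', .cons h q, ?_, ?_, ?_⟩
      · rw [SimpleGraph.Walk.cons_isPath_iff]
        exact ⟨hq, fun hu => hp.2 (hqp _ hu)⟩
      · intro w hw
        simp only [SimpleGraph.Walk.support_cons, List.mem_cons] at hw ⊢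
        exact hw.imp id (hqp w)
      · intro w hw hwB
        simp only [SimpleGraph.Walk.support_cons, List.mem_cons] at hw
        rcases hw with rfl | hw
        · exact absurd hwB hy
        · exact hqB w hw hwB

/-- A path-convex set together with a block that it meets in one vertex is path-convex. -/
lemma PathConvex.union_block {W : Type*} {H : SimpleGraph W} {S B : Set W} (hS : PathConvex H S)
    (hB : IsBlockSet H B) {a : W} (ha : a ∈ S) (haB : a ∈ B)
    (hSB : ∀ b ∈ S, b ∈ B → b = a) : PathConvex H (S ∪ B) := by
  have mixed : ∀ y ∈ S, ∀ z ∈ B, ∀ p : H.Walk y z, p.IsPath → ∀ w ∈ p.support, w ∈ S ∪ B := by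
    intro y hy z hz p hp w hw
    by_cases hap : a ∈ p.support
    · obtain ⟨q, r, hq, hr, rfl⟩ := hp.mem_support_iff_exists_append.1 hap
      rw [SimpleGraph.Walk.mem_support_append_iff] at hw
      rcases hw with hw | hw
      · exact Or.inl (hS y hy a ha q hq w hw)
      · exact Or.inr (hB.pathConvex a haB z hz r hr w hw)
    -- otherwise the path enters `B` at some `z' ∉ S`, and continues to `a` inside `B`
    exfalso
    have hyB : y ∉ B := fun h => hap (hSB y hy h ▸ p.start_mem_support)
    obtain ⟨z', hz', q, hq, hqp, hqB⟩ := exists_path_to_first p hp hyB hz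
    have hz'S : z' ∉ S := fun h => hap (hSB z' h hz' ▸ hqp _ q.end_mem_support)
    obtain ⟨r, hr, hrB⟩ := exists_path_of_reflTransGen (U := B) hz' (hB.1.2.1 z' hz' a haB)
    refine hz'S (hS y hy a ha (q.append r) ?_ z' (by simp))
    rw [SimpleGraph.Walk.isPath_def, SimpleGraph.Walk.support_append, List.nodup_append]
    refine ⟨hq.support_nodup, hr.support_nodup.sublist (List.tail_sublist _), ?_⟩
    rintro u hu _ hv rfl
    have := hqB u hu (hrB u (List.mem_of_mem_tail hv))
    subst this
    have hnd := hr.support_nodup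
    rw [← SimpleGraph.Walk.cons_tail_support, List.nodup_cons] at hnd
    exact hnd.1 hv
  rintro y (hy | hy) z (hz | hz) p hp w hw
  · exact Or.inl (hS y hy z hz p hp w hw)
  · exact mixed y hy z hz p hp w hw
  · exact mixed z hz y hy p.reverse hp.reverse w (by simpa using hw)
  · exact Or.inr (hB.pathConvex y hy z hz p hp w hw)

/-- A rooted block decomposition of the part of `H` on `S`. The parts are numbered from `1` to `m` in
the order in which they were added, and `o v = 0` stands for the root block `P`. -/
structure PartialDecomp {W : Type*} (H : SimpleGraph W) (P S : Set W) (m : ℕ) (o : W → ℕ)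
    (f : ℕ → W) : Prop where
  sub : P ⊆ S
  convex : PathConvex H S
  zero : ∀ v ∈ S, o v = 0 ↔ v ∈ P
  le : ∀ v ∈ S, o v ≤ m
  parent : ∀ j, 1 ≤ j → j ≤ m → f j ∈ S ∧ o (f j) < j
  part : ∀ j, 1 ≤ j → j ≤ m → ∃ v ∈ S, o v = j
  block : ∀ j, 1 ≤ j → j ≤ m → IsBlockSet H (insert (f j) {v | v ∈ S ∧ o v = j})
  adj : ∀ u ∈ S, ∀ v ∈ S, H.Adj u v →
    o u = o v ∨ (o u ≠ 0 ∧ v = f (o u)) ∨ (o v ≠ 0 ∧ u = f (o v))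

lemma PartialDecomp.grow {W : Type*} [Finite W] {H : SimpleGraph W} {P S : Set W} {m : ℕ}
    {o : W → ℕ} {f : ℕ → W} (h : PartialDecomp H P S m o f) {a x : W} (ha : a ∈ S) (hx : x ∉ S)
    (hax : H.Adj a x) :
    ∃ S' o' f', S ⊂ S' ∧ PartialDecomp H P S' (m + 1) o' f' := by
  classical
  obtain ⟨B, hB, hsub⟩ := exists_isBlockSet_superset (nonseparable_pair hax)
  have haB : a ∈ B := hsub (by simp)
  have hxB : x ∈ B := hsub (by simp)
  have hSB : ∀ b ∈ S, b ∈ B → b = a := fun b hb hbB =>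
    h.convex.inter_block hB ha hx hxB hax hb hbB
  -- an edge from `S` to a new vertex of `B` starts at `a`
  have hedge : ∀ u ∈ S, ∀ v ∈ B, v ∉ S → H.Adj u v → u = a := by
    intro u hu v hv hvS huv
    by_contra hne
    have huB : u ∉ B := fun h' => hne (hSB u hu h')
    obtain ⟨p, hp, hpB⟩ := exists_path_of_reflTransGen (U := B) hv (hB.1.2.1 v hv a haB)
    refine hvS (h.convex u hu a ha (.cons huv p) ?_ v (by simp))
    rw [SimpleGraph.Walk.cons_isPath_iff]
    exact ⟨hp, fun h' => huB (hpB u h')⟩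
  set o' : W → ℕ := fun v => if v ∈ S then o v else m + 1 with ho'
  have hoS : ∀ v ∈ S, o' v = o v := fun v hv => if_pos hv
  have hoN : ∀ v, v ∉ S → o' v = m + 1 := fun v hv => if_neg hv
  set f' : ℕ → W := Function.update f (m + 1) a with hf'
  have hfm : f' (m + 1) = a := Function.update_self ..
  have hfj : ∀ j, j ≤ m → f' j = f j := fun j hj => Function.update_of_ne (by omega) ..
  refine ⟨S ∪ B, o', f', ⟨Set.subset_union_left, fun h' => hx (h' (Or.inr hxB))⟩, ?_⟩
  have hpart : ∀ j, j ≤ m → {v | v ∈ S ∪ B ∧ o' v = j} = {v | v ∈ S ∧ o v = j} := by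
    intro j hj
    ext v
    constructor
    · rintro ⟨hv, hv'⟩
      by_cases hvS : v ∈ S
      · exact ⟨hvS, hoS v hvS ▸ hv'⟩
      · rw [hoN v hvS] at hv'; omega
    · rintro ⟨hv, hv'⟩
      exact ⟨Or.inl hv, (hoS v hv).trans hv'⟩
  have hnew : insert a {v | v ∈ S ∪ B ∧ o' v = m + 1} = B := by
    ext v
    constructor
    · rintro (rfl | ⟨hv, hv'⟩)
      · exact haB
      · by_cases hvS : v ∈ S
        · have := h.le v hvS
          rw [hoS v hvS] at hv'; omega
        · exact hv.resolve_left hvS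
    · intro hv
      by_cases hvS : v ∈ S
      · exact Or.inl (hSB v hvS hv)
      · exact Or.inr ⟨Or.inr hv, hoN v hvS⟩
  refine ⟨h.sub.trans Set.subset_union_left, h.convex.union_block hB ha haB hSB, ?_, ?_, ?_, ?_, ?_,
    ?_⟩
  · intro v hv
    by_cases hvS : v ∈ S
    · rw [hoS v hvS]; exact h.zero v hvS
    · rw [hoN v hvS]
      exact ⟨fun h' => by omega, fun h' => absurd (h.sub h') hvS⟩
  · intro v hv
    by_cases hvS : v ∈ S
    · rw [hoS v hvS]; exact (h.le v hvS).trans (Nat.le_succ m)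
    · rw [hoN v hvS]
  · intro j h1 hj
    rcases Nat.le_succ_iff.1 hj with hj | rfl
    · rw [hfj j hj, hoS _ (h.parent j h1 hj).1]
      exact ⟨Or.inl (h.parent j h1 hj).1, (h.parent j h1 hj).2⟩
    · rw [hfm, hoS a ha]
      exact ⟨Or.inl ha, Nat.lt_succ_of_le (h.le a ha)⟩
  · intro j h1 hj
    rcases Nat.le_succ_iff.1 hj with hj | rfl
    · obtain ⟨v, hv, hvj⟩ := h.part j h1 hj
      exact ⟨v, Or.inl hv, (hoS v hv).trans hvj⟩
    · exact ⟨x, Or.inr hxB, hoN x hx⟩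
  · intro j h1 hj
    rcases Nat.le_succ_iff.1 hj with hj | rfl
    · rw [hfj j hj, hpart j hj]
      exact h.block j h1 hj
    · rw [hfm, hnew]
      exact hB
  · intro u hu v hv huv
    by_cases huS : u ∈ S <;> by_cases hvS : v ∈ S
    · rw [hoS u huS, hoS v hvS, hfj _ (h.le u huS), hfj _ (h.le v hvS)]
      exact h.adj u huS v hvS huv
    · rw [hoN v hvS, hfm]
      exact Or.inr (Or.inr ⟨by omega, hedge u huS v (hv.resolve_left hvS) hvS huv⟩)
    · rw [hoN u huS, hfm]
      exact Or.inr (Or.inl ⟨by omega, hedge v hvS u (hu.resolve_left huS) huS huv.symm⟩)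
    · rw [hoN u huS, hoN v hvS]
      exact Or.inl rfl

lemma exists_partialDecomp_univ {W : Type*} [Finite W] {H : SimpleGraph W} (hH : H.Preconnected)
    {P : Set W} (hP : IsBlockSet H P) :
    ∃ m o f, PartialDecomp H P Set.univ m o f := by
  have key : ∀ n : ℕ, ∀ S m o f, PartialDecomp H P S m o f → Sᶜ.ncard ≤ n →
      ∃ m o f, PartialDecomp H P Set.univ m o f := by
    intro n
    induction n with
    | zero =>
      intro S m o f h hn
      have : S = Set.univ := by
        rw [← Set.compl_empty_iff, ← Set.ncard_eq_zero (Set.toFinite _)]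
        omega
      subst this
      exact ⟨m, o, f, h⟩
    | succ n ih =>
      intro S m o f h hn
      by_cases hS : S = Set.univ
      · subst hS
        exact ⟨m, o, f, h⟩
      obtain ⟨x, hx⟩ := (Set.ne_univ_iff_exists_notMem S).1 hS
      obtain ⟨p0, hp0⟩ := hP.1.1
      obtain ⟨w⟩ := hH p0 x
      obtain ⟨d, -, hd1, hd2⟩ := w.exists_boundary_dart S (h.sub hp0) hx
      obtain ⟨S', o', f', hSS', h'⟩ := h.grow hd1 hd2 d.adj
      refine ih S' _ o' f' h' ?_
      have := Set.ncard_lt_ncard (compl_lt_compl_iff_lt.2 hSS') (Set.toFinite _)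
      omega
  obtain ⟨p0, hp0⟩ := hP.1.1
  refine key _ P 0 (fun _ => 0) (fun _ => p0) ⟨subset_rfl, hP.pathConvex, ?_, ?_, ?_, ?_, ?_, ?_⟩ le_rfl
  · intro v hv; simpa using hv
  · intro v hv; simp
  · intro j h1 h2; omega
  · intro j h1 h2; omega
  · intro j h1 h2; omega
  · intro u _ v _ _; exact Or.inl rfl

/-- A connected graph has a rooted block decomposition with any prescribed root block. -/
theorem exists_decomp {W : Type*} [Finite W] {H : SimpleGraph W} (hH : H.Preconnected)
    {P : Set W} (hP : IsBlockSet H P) :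
    ∃ (m : ℕ) (o : W → Option (Fin m)) (f : Fin m → W), Decomp H o f ∧ {v | o v = none} = P := by
  obtain ⟨m, o, f, h⟩ := exists_partialDecomp_univ hH hP
  set o' : W → Option (Fin m) := fun v =>
    if hv : o v = 0 then none
    else some ⟨o v - 1, by have := h.le v trivial; omega⟩ with ho'
  have hnone : ∀ v, o' v = none ↔ o v = 0 := by
    intro v
    by_cases hv : o v = 0 <;> simp [ho', hv]
  have hsome : ∀ v (i : Fin m), o' v = some i ↔ o v = i + 1 := by
    intro v i
    by_cases hv : o v = 0
    · simp [ho', hv]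
    · simp only [ho', hv, dite_false, Option.some.injEq, Fin.ext_iff]
      omega
  have hroot : {v | o' v = none} = P := by
    ext v; exact (hnone v).trans (h.zero v trivial)
  refine ⟨m, o', fun i => f (i + 1), ⟨⟨fun i => i, ?_⟩, ?_, ?_, hroot ▸ hP.1, ?_, ?_⟩, hroot⟩
  · intro i j hij
    have hij : o (f (i + 1)) = j + 1 := (hsome _ _).1 hij
    have := (h.parent (i + 1) (by omega) (by omega)).2
    change (j : ℕ) < i
    omega
  · intro u v huv
    have aux : ∀ u v, o u ≠ 0 ∧ v = f (o u) → ∃ i : Fin m, o' u = some i ∧ v = f (i + 1) := by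
      rintro u v ⟨hu, hv⟩
      have := h.le u trivial
      have h1 : o u - 1 + 1 = o u := by omega
      exact ⟨⟨o u - 1, by omega⟩, (hsome _ _).2 h1.symm, by simpa [h1] using hv⟩
    rcases h.adj u trivial v trivial huv with h1 | h1 | h1
    · left
      simp only [ho', h1]
    · exact Or.inr (Or.inl (aux u v h1))
    · exact Or.inr (Or.inr (aux v u h1))
  · intro i
    obtain ⟨v, -, hv⟩ := h.part (i + 1) (by omega) (by omega)
    exact ⟨v, (hsome v i).2 hv⟩
  · rintro ⟨i⟩
    rw [hroot]
    by_contra hnt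
    rw [Set.not_nontrivial_iff] at hnt
    obtain ⟨p, hp⟩ := hP.1.1
    have hPp : P = {p} := hnt.eq_singleton_of_mem hp
    obtain ⟨x, -, hx⟩ := h.part (i + 1) (by omega) (by omega)
    have hxp : p ≠ x := by
      rintro rfl
      have := (h.zero p trivial).2 hp
      omega
    obtain ⟨w⟩ := hH p x
    cases w with
    | nil => exact hxp rfl
    | cons hadj _ => exact IsBlockSet.eq_singleton (hPp ▸ hP) _ hadj
  · intro i
    have := (h.block (i + 1) (by omega) (by omega)).1
    have hs : {v | o' v = some i} = {v | v ∈ Set.univ ∧ o v = i + 1} := by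
      ext v; simp [hsome]
    rwa [hs]

/-! ### Rooted block decompositions: blocks, connectivity, uniqueness -/

/-- The block with a given index: the root block for `none`, and the part `i` together with its
parent vertex for `some i`. -/
def blockOf {W ι : Type*} (o : W → Option ι) (f : ι → W) : Option ι → Set W
  | none => {v | o v = none}
  | some i => insert (f i) {v | o v = some i}

lemma Acyclic.ne_self {W ι : Type*} {o : W → Option ι} {f : ι → W} (h : Acyclic o f) (i : ι) :
    o (f i) ≠ some i := by
  obtain ⟨r, hr⟩ := h
  exact fun hi => (hr i i hi).ne rfl

lemma Acyclic.asymm {W ι : Type*} {o : W → Option ι} {f : ι → W} (h : Acyclic o f) {i j : ι}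
    (hij : o (f i) = some j) : o (f j) ≠ some i := by
  obtain ⟨r, hr⟩ := h
  exact fun hji => (hr i j hij).asymm (hr j i hji)

lemma Decomp.nonseparable_blockOf {W ι : Type*} {H : SimpleGraph W} {o : W → Option ι} {f : ι → W}
    (h : Decomp H o f) : ∀ x, Nonseparable H (blockOf o f x)
  | none => h.root
  | some i => h.block i

/-- Each nonseparable set lies in one of the blocks of the decomposition. If the set meets some part,
take such a part of largest rank: removing its parent vertex from the set would otherwise disconnect
the set. -/
lemma Decomp.exists_subset_blockOf {W ι : Type*} [Finite W] {H : SimpleGraph W} {o : W → Option ι}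
    {f : ι → W} (h : Decomp H o f) {U : Set W} (hU : Nonseparable H U) :
    ∃ x, U ⊆ blockOf o f x := by
  obtain ⟨r, hr⟩ := h.acyclic
  set R : W → ℕ := fun v => (o v).elim 0 fun i => r i + 1 with hR
  obtain ⟨v, hv, hmax⟩ := Set.exists_max_image U R (Set.toFinite _) hU.1
  cases hov : o v with
  | none =>
    refine ⟨none, fun u hu => ?_⟩
    have := hmax u hu
    cases hou : o u with
    | none => exact hou
    | some j => simp [hR, hov, hou] at this
  | some i =>
    refine ⟨some i, fun u hu => ?_⟩
    by_cases hui : u = f i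
    · exact Or.inl hui
    have hvi : v ≠ f i := by
      rintro rfl; exact h.acyclic.ne_self i hov
    have hc := hU.2.2 (f i) v ⟨hv, hvi⟩ u ⟨hu, hui⟩
    refine Or.inr ?_
    change o u = some i
    clear hu hui
    induction hc with
    | refl => exact hov
    | @tail x y _ hxy ih =>
      obtain ⟨hadj, -, hyU, hyi⟩ := hxy
      rcases h.adj x y hadj with h1 | ⟨j, h1, h2⟩ | ⟨j, h1, h2⟩
      · rw [← h1]; exact ih
      · rw [ih, Option.some.injEq] at h1
        exact absurd (h1 ▸ h2) hyi
      · have h3 := hr j i (h2 ▸ ih)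
        have h4 := hmax y hyU
        simp only [hR, hov, h1, Option.elim_some] at h4
        omega

lemma Decomp.eq_of_blockOf_subset {W ι : Type*} {H : SimpleGraph W} {o : W → Option ι} {f : ι → W}
    (h : Decomp H o f) {x y : Option ι} (hxy : blockOf o f x ⊆ blockOf o f y) : x = y := by
  cases x with
  | none =>
    cases y with
    | none => rfl
    | some j =>
      exfalso
      obtain ⟨a, ha, b, hb, hab⟩ := h.root_nontrivial ⟨j⟩
      have aux : ∀ c, o c = none → c = f j := by
        intro c hc
        rcases hxy hc with h1 | h1
        · exact h1
        · exact absurd (hc.symm.trans h1) (by simp)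
      exact hab ((aux a ha).trans (aux b hb).symm)
  | some i =>
    obtain ⟨v, hv⟩ := h.part_nonempty i
    have hvi : v ∈ blockOf o f y := hxy (Or.inr hv)
    cases y with
    | none => exact absurd (hv.symm.trans hvi) (by simp)
    | some j =>
      rcases hvi with h1 | h1
      · -- here `v = f j`, and `f i` lies in part `j`, which gives a cycle
        have hij : o (f j) = some i := h1 ▸ hv
        rcases hxy (Set.mem_insert (f i) _) with h2 | h2
        · exact absurd (h2 ▸ hij) (h.acyclic.ne_self i)
        · exact absurd h2 (h.acyclic.asymm hij)
      · exact hv.symm.trans h1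

lemma Decomp.isBlockSet_iff {W ι : Type*} [Finite W] {H : SimpleGraph W} {o : W → Option ι}
    {f : ι → W} (h : Decomp H o f) {U : Set W} : IsBlockSet H U ↔ ∃ x, blockOf o f x = U := by
  constructor
  · intro hU
    obtain ⟨x, hx⟩ := h.exists_subset_blockOf hU.1
    exact ⟨x, (hU.eq_of_subset (h.nonseparable_blockOf x) hx).symm⟩
  · rintro ⟨x, rfl⟩
    refine ⟨h.nonseparable_blockOf x, fun U hU hs => ?_⟩
    obtain ⟨y, hy⟩ := h.exists_subset_blockOf hU
    obtain rfl := h.eq_of_blockOf_subset (hs.trans hy)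
    exact hy

/-- The blocks of a graph with a rooted block decomposition: the root block and one block for each
part. -/
def Decomp.equiv {W ι : Type*} [Finite W] {H : SimpleGraph W} {o : W → Option ι}
    {f : ι → W} (h : Decomp H o f) : Option ι ≃ BlockSet H :=
  Equiv.ofBijective (fun x => ⟨blockOf o f x, h.isBlockSet_iff.2 ⟨x, rfl⟩⟩)
    ⟨fun _ _ hxy => h.eq_of_blockOf_subset (Subtype.ext_iff.1 hxy).subset, fun U => by
      obtain ⟨x, hx⟩ := h.isBlockSet_iff.1 U.2
      exact ⟨x, Subtype.ext hx⟩⟩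

lemma reachable_of_connectsOn {W : Type*} {H : SimpleGraph W} {U : Set W}
    (h : ConnectsOn H.Adj U) {a b : W} (ha : a ∈ U) (hb : b ∈ U) : H.Reachable a b :=
  (SimpleGraph.reachable_iff_reflTransGen _ _).2 ((h a ha b hb).lift id fun _ _ h' => h'.1)

lemma Decomp.preconnected {W ι : Type*} {H : SimpleGraph W} {o : W → Option ι} {f : ι → W}
    (h : Decomp H o f) : H.Preconnected := by
  obtain ⟨p, hp⟩ := h.root.1
  obtain ⟨r, hr⟩ := h.acyclic
  have key : ∀ n i v, r i ≤ n → o v = some i → H.Reachable v p := by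
    intro n
    induction n with
    | zero =>
      intro i v hi hv
      have h1 := reachable_of_connectsOn (h.block i).2.1 (Or.inr hv) (Or.inl rfl)
      cases hf : o (f i) with
      | none => exact h1.trans (reachable_of_connectsOn h.root.2.1 hf hp)
      | some j => have := hr i j hf; omega
    | succ n ih =>
      intro i v hi hv
      have h1 := reachable_of_connectsOn (h.block i).2.1 (Or.inr hv) (Or.inl rfl)
      cases hf : o (f i) with
      | none => exact h1.trans (reachable_of_connectsOn h.root.2.1 hf hp)
      | some j =>
        have := hr i j hf
        exact h1.trans (ih j _ (by omega) hf)
  have key' : ∀ v, H.Reachable v p := by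
    intro v
    cases hv : o v with
    | none => exact reachable_of_connectsOn h.root.2.1 hv hp
    | some i => exact key _ i v le_rfl hv
  exact fun a b => (key' a).trans (key' b).symm

lemma Decomp.parent_eq {W ι κ : Type*} [Finite W] {H : SimpleGraph W} {o : W → Option ι}
    {f : ι → W} {o' : W → Option κ} {f' : κ → W} (h : Decomp H o f) (h' : Decomp H o' f')
    (hroot : {v | o v = none} = {v | o' v = none}) :
    (∀ i, ∃ j, blockOf o f (some i) = blockOf o' f' (some j)) ∧
    ∀ i j, blockOf o f (some i) = blockOf o' f' (some j) → f i = f' j := by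
  have hex : ∀ i, ∃ j, blockOf o f (some i) = blockOf o' f' (some j) := by
    intro i
    obtain ⟨x, hx⟩ := h'.isBlockSet_iff.1 (h.isBlockSet_iff.2 ⟨some i, rfl⟩)
    cases x with
    | none =>
      have : blockOf o f none = blockOf o f (some i) := hroot.trans hx
      exact absurd (h.eq_of_blockOf_subset this.subset) (by simp)
    | some j => exact ⟨j, hx.symm⟩
  refine ⟨hex, ?_⟩
  obtain ⟨r, hr⟩ := h.acyclic
  have key : ∀ n i j, r i < n → blockOf o f (some i) = blockOf o' f' (some j) → f i = f' j := by
    intro n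
    induction n with
    | zero => intro i j hi; omega
    | succ n ih =>
      intro i j hi hij
      by_contra hne
      have h1 : f i ∈ blockOf o' f' (some j) := hij ▸ Set.mem_insert (f i) _
      have h2 : o' (f i) = some j := h1.resolve_left hne
      cases hf : o (f i) with
      | none =>
        have h3 : o' (f i) = none := hroot.subset hf
        rw [h2] at h3; cases h3
      | some i' =>
        obtain ⟨j', hj'⟩ := hex i'
        have h4 := ih i' j' (by have := hr i i' hf; omega) hj'
        have h5 : f i ∈ blockOf o' f' (some j') := hj' ▸ Or.inr hf
        have h6 : f i ≠ f' j' := by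
          intro h7
          have : o (f i') = some i' := by rw [h4, ← h7]; exact hf
          exact h.acyclic.ne_self i' this
        have h7 : o' (f i) = some j' := h5.resolve_left h6
        rw [h2, Option.some.injEq] at h7
        subst h7
        have h8 := h.eq_of_blockOf_subset (hij.trans hj'.symm).subset
        rw [Option.some.injEq] at h8
        subst h8
        exact h.acyclic.ne_self i hf
  exact fun i j => key _ i j (Nat.lt_succ_self _)

/-- The rooted block decomposition is determined by the graph and the root block, up to the names of
the parts. -/
theorem Decomp.unique {W ι κ : Type*} [Finite W] {H : SimpleGraph W} {o : W → Option ι}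
    {f : ι → W} {o' : W → Option κ} {f' : κ → W} (h : Decomp H o f) (h' : Decomp H o' f')
    (hroot : {v | o v = none} = {v | o' v = none}) :
    ∃ σ : ι ≃ κ, (∀ v, o' v = (o v).map σ) ∧ ∀ i, f' (σ i) = f i := by
  obtain ⟨hex, heq⟩ := h.parent_eq h' hroot
  obtain ⟨hex', heq'⟩ := h'.parent_eq h hroot.symm
  choose s hs using hex
  have hbij : Function.Bijective s := by
    constructor
    · intro i i' hii
      have := h.eq_of_blockOf_subset (x := some i) (y := some i')
        (by rw [hs i, hs i', hii])
      simpa using this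
    · intro j
      obtain ⟨i, hi⟩ := hex' j
      refine ⟨i, ?_⟩
      have := h'.eq_of_blockOf_subset (x := some (s i)) (y := some j) (by rw [← hs i, hi])
      simpa using this
  refine ⟨Equiv.ofBijective s hbij, fun v => ?_, fun i => (heq i (s i) (hs i)).symm⟩
  cases hv : o v with
  | none => exact hroot.subset hv
  | some i =>
    have h1 : v ∈ blockOf o' f' (some (s i)) := hs i ▸ Or.inr hv
    refine h1.resolve_left fun h2 => h.acyclic.ne_self i ?_
    rw [heq i (s i) (hs i), ← h2]
    exact hv

/-! ### Reattaching the parts -/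

/-- The graph obtained from `H` by moving each part `i` from its parent vertex `f i` to the vertex
`f' i`. -/
def reattach {W ι : Type*} (H : SimpleGraph W) (o : W → Option ι) (f f' : ι → W) :
    SimpleGraph W where
  Adj u v := u ≠ v ∧ ((H.Adj u v ∧ o u = o v) ∨
    (∃ i, o u = some i ∧ H.Adj u (f i) ∧ v = f' i) ∨ ∃ i, o v = some i ∧ H.Adj v (f i) ∧ u = f' i)
  symm := ⟨fun _ _ h => ⟨h.1.symm, h.2.imp (fun h' => ⟨h'.1.symm, h'.2.symm⟩) Or.symm⟩⟩
  loopless := ⟨fun _ h => h.1 rfl⟩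

lemma reattach_adj_of_owner_eq {W ι : Type*} {H : SimpleGraph W} {o : W → Option ι} {f f' : ι → W}
    (hf' : Acyclic o f') {x y : W} (hxy : o x = o y) :
    (reattach H o f f').Adj x y ↔ H.Adj x y := by
  constructor
  · rintro ⟨-, h | ⟨i, h1, -, rfl⟩ | ⟨i, h1, -, rfl⟩⟩
    · exact h.1
    · exact absurd (hxy.symm.trans h1) (hf'.ne_self i)
    · exact absurd (hxy.trans h1) (hf'.ne_self i)
  · exact fun h => ⟨h.ne, Or.inl ⟨h, hxy⟩⟩

lemma reattach_adj_parent {W ι : Type*} {H : SimpleGraph W} {o : W → Option ι} {f f' : ι → W}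
    (hf' : Acyclic o f') {y : W} {i : ι} (hy : o y = some i) :
    (reattach H o f f').Adj y (f' i) ↔ H.Adj y (f i) := by
  constructor
  · rintro ⟨-, h | ⟨j, h1, h2, -⟩ | ⟨j, h1, -, rfl⟩⟩
    · exact absurd (h.2.symm.trans hy) (hf'.ne_self i)
    · rw [hy, Option.some.injEq] at h1
      exact h1 ▸ h2
    · exact absurd hy (hf'.asymm h1)
  · intro h
    refine ⟨?_, Or.inr (Or.inl ⟨i, hy, h, rfl⟩)⟩
    rintro rfl
    exact hf'.ne_self i hy

lemma Decomp.reattach_self {W ι : Type*} {H : SimpleGraph W} {o : W → Option ι} {f : ι → W}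
    (h : Decomp H o f) : reattach H o f f = H := by
  ext x y
  constructor
  · rintro ⟨-, h | ⟨i, -, h, rfl⟩ | ⟨i, -, h, rfl⟩⟩
    · exact h.1
    · exact h
    · exact h.symm
  · intro hxy
    refine ⟨hxy.ne, ?_⟩
    rcases h.adj x y hxy with h1 | ⟨i, h1, rfl⟩ | ⟨i, h1, rfl⟩
    · exact Or.inl ⟨hxy, h1⟩
    · exact Or.inr (Or.inl ⟨i, h1, hxy, rfl⟩)
    · exact Or.inr (Or.inr ⟨i, h1, hxy.symm, rfl⟩)

lemma reattach_reattach {W ι : Type*} {H : SimpleGraph W} {o : W → Option ι} {f f' f'' : ι → W}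
    (hf' : Acyclic o f') :
    reattach (reattach H o f f') o f' f'' = reattach H o f f'' := by
  ext x y
  refine and_congr_right fun _ => or_congr ?_ (or_congr ?_ ?_)
  · exact and_congr_left fun h => reattach_adj_of_owner_eq hf' h
  · exact exists_congr fun i => and_congr_right fun h =>
      and_congr_left fun _ => reattach_adj_parent hf' h
  · exact exists_congr fun i => and_congr_right fun h =>
      and_congr_left fun _ => reattach_adj_parent hf' h

lemma reattach_relabel {W ι κ : Type*} {H : SimpleGraph W} {o : W → Option ι} {o' : W → Option κ}
    {f g : ι → W} {f' g' : κ → W} (σ : ι ≃ κ) (ho : ∀ v, o' v = (o v).map σ)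
    (hf : ∀ i, f' (σ i) = f i) (hg : ∀ i, g' (σ i) = g i) :
    reattach H o' f' g' = reattach H o f g := by
  have aux : ∀ v i, o' v = some (σ i) ↔ o v = some i := by
    intro v i
    rw [ho]
    cases o v <;> simp
  ext x y
  refine and_congr_right fun _ => or_congr ?_ (or_congr ?_ ?_)
  · rw [ho, ho, (Option.map_injective σ.injective).eq_iff]
  · rw [← σ.exists_congr_right]
    simp only [aux, hf, hg]
  · rw [← σ.exists_congr_right]
    simp only [aux, hf, hg]

lemma Acyclic.relabel {W ι κ : Type*} {o : W → Option ι} {o' : W → Option κ}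
    {f : ι → W} {f' : κ → W} (h : Acyclic o' f') (σ : ι ≃ κ) (ho : ∀ v, o' v = (o v).map σ)
    (hf : ∀ i, f' (σ i) = f i) : Acyclic o f := by
  obtain ⟨r, hr⟩ := h
  refine ⟨fun i => r (σ i), fun i j hij => hr _ _ ?_⟩
  rw [hf, ho, hij, Option.map_some]

lemma Nonseparable.image {V W : Type*} {G : SimpleGraph V} {H : SimpleGraph W} {U : Set V}
    (h : Nonseparable G U) (φ : V → W) (hinj : Set.InjOn φ U)
    (hφ : ∀ x ∈ U, ∀ y ∈ U, G.Adj x y → H.Adj (φ x) (φ y)) : Nonseparable H (φ '' U) := by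
  refine ⟨h.1.image φ, h.2.1.image φ hφ, fun w => ?_⟩
  by_cases hw : w ∈ φ '' U
  · obtain ⟨v, hv, rfl⟩ := hw
    have : φ '' U \ {φ v} = φ '' (U \ {v}) := by
      ext z
      constructor
      · rintro ⟨⟨u, hu, rfl⟩, hne⟩
        exact ⟨u, ⟨hu, fun h' => hne (congrArg φ h')⟩, rfl⟩
      · rintro ⟨u, ⟨hu, hne⟩, rfl⟩
        exact ⟨⟨u, hu, rfl⟩, fun h' => hne (hinj hu hv h')⟩
    rw [this]
    exact (h.2.2 v).image φ fun x hx y hy => hφ x hx.1 y hy.1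
  · rw [Set.sdiff_singleton_eq_self hw]
    exact h.2.1.image φ hφ

/-- The bijection from a block to the corresponding block after reattaching: it moves the parent
vertex and fixes the other vertices. -/
lemma reattach_blockOf_iso {W ι : Type*} {H : SimpleGraph W} {o : W → Option ι} {f f' : ι → W}
    (hf : Acyclic o f) (hf' : Acyclic o f') (x : Option ι) :
    ∃ φ : W → W, Set.InjOn φ (blockOf o f x) ∧ φ '' blockOf o f x = blockOf o f' x ∧
      ∀ u ∈ blockOf o f x, ∀ v ∈ blockOf o f x,
        ((reattach H o f f').Adj (φ u) (φ v) ↔ H.Adj u v) := by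
  classical
  cases x with
  | none =>
    refine ⟨id, Set.injOn_id _, by simp [blockOf], fun u hu v hv => ?_⟩
    exact reattach_adj_of_owner_eq hf' (hu.trans hv.symm)
  | some i =>
    set φ : W → W := fun v => if v = f i then f' i else v with hφ
    have h1 : φ (f i) = f' i := if_pos rfl
    have h2 : ∀ v, o v = some i → φ v = v := by
      intro v hv
      exact if_neg (by rintro rfl; exact hf.ne_self i hv)
    refine ⟨φ, ?_, ?_, ?_⟩
    · rintro u (rfl | hu) v (rfl | hv) huv
      · rfl
      · rw [h1, h2 v hv] at huv
        exact absurd (huv ▸ hv) (hf'.ne_self i)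
      · rw [h1, h2 u hu] at huv
        exact absurd (huv ▸ hu) (hf'.ne_self i)
      · rwa [h2 u hu, h2 v hv] at huv
    · ext w
      constructor
      · rintro ⟨u, rfl | hu, rfl⟩
        · exact Or.inl h1
        · exact Or.inr (by rw [h2 u hu]; exact hu)
      · rintro (rfl | hw)
        · exact ⟨f i, Or.inl rfl, h1⟩
        · exact ⟨w, Or.inr hw, h2 w hw⟩
    · rintro u (rfl | hu) v (rfl | hv)
      · simp
      · rw [h1, h2 v hv, SimpleGraph.adj_comm, reattach_adj_parent hf' hv, SimpleGraph.adj_comm]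
      · rw [h1, h2 u hu, reattach_adj_parent hf' hu]
      · rw [h2 u hu, h2 v hv, reattach_adj_of_owner_eq hf' (Eq.trans hu (Eq.symm hv))]

/-- Reattaching along another acyclic map gives a graph with the same parts. -/
theorem Decomp.reattach {W ι : Type*} {H : SimpleGraph W} {o : W → Option ι} {f f' : ι → W}
    (h : Decomp H o f) (hf' : Acyclic o f') : Decomp (reattach H o f f') o f' := by
  have hns : ∀ x, Nonseparable (BlockStable.reattach H o f f') (blockOf o f' x) := by
    intro x
    obtain ⟨φ, hinj, him, hadj⟩ := reattach_blockOf_iso (H := H) h.acyclic hf' x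
    rw [← him]
    exact (h.nonseparable_blockOf x).image φ hinj fun u hu v hv => (hadj u hu v hv).2
  refine ⟨hf', ?_, h.part_nonempty, hns none, h.root_nontrivial, fun i => hns (some i)⟩
  rintro u v ⟨-, h1 | ⟨i, h1, -, h2⟩ | ⟨i, h1, -, h2⟩⟩
  · exact Or.inl h1.2
  · exact Or.inr (Or.inl ⟨i, h1, h2⟩)
  · exact Or.inr (Or.inr ⟨i, h1, h2⟩)

theorem Decomp.sameBlocks_reattach {W ι : Type*} [Finite W] {H : SimpleGraph W} {o : W → Option ι}
    {f f' : ι → W} (h : Decomp H o f) (hf' : Acyclic o f') :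
    SameBlocks H (BlockStable.reattach H o f f') := by
  have h' := h.reattach hf'
  refine sameBlocks_of_equiv (h.equiv.symm.trans h'.equiv) fun U => ?_
  obtain ⟨x, rfl⟩ := h.equiv.surjective U
  rw [Equiv.trans_apply, Equiv.symm_apply_apply]
  obtain ⟨φ, hinj, him, hadj⟩ := reattach_blockOf_iso (H := H) h.acyclic hf' x
  have hbij : Set.BijOn φ (blockOf o f x) (blockOf o f' x) := him ▸ hinj.bijOn_image
  exact ⟨⟨hbij.equiv, fun {a b} => hadj a a.2 b b.2⟩⟩

/-- Different acyclic maps give different graphs. -/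
theorem Decomp.reattach_injective {W ι : Type*} [Finite W] {H : SimpleGraph W} {o : W → Option ι}
    {f f₁ f₂ : ι → W} (h : Decomp H o f) (h₁ : Acyclic o f₁) (h₂ : Acyclic o f₂)
    (he : BlockStable.reattach H o f f₁ = BlockStable.reattach H o f f₂) : f₁ = f₂ := by
  obtain ⟨σ, hσ, hf⟩ := (h.reattach h₁).unique (he ▸ h.reattach h₂) rfl
  funext i
  obtain ⟨v, hv⟩ := h.part_nonempty i
  have := hσ v
  rw [hv, Option.map_some, Option.some.injEq] at this
  rw [← hf i, ← this]

/-! ### Chains of blocks -/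

/-- The block `P` is joined to `Q` by a chain of `t` blocks (repetitions allowed), starting after `P`
and ending in `Q`, in which consecutive blocks meet. -/
def Near {V : Type*} (G : SimpleGraph V) : ℕ → Set V → Set V → Prop
  | 0, P, Q => P = Q
  | t + 1, P, Q => ∃ R, IsBlockSet G R ∧ (P ∩ R).Nonempty ∧ Near G t R Q

lemma near_self {V : Type*} {G : SimpleGraph V} {P : Set V} (hP : IsBlockSet G P) :
    ∀ t, Near G t P P
  | 0 => rfl
  | t + 1 => ⟨P, hP, by rw [Set.inter_self]; exact hP.1.1, near_self hP t⟩

/-- The first `t` steps from part `i` along the parent map do not reach the root block. -/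
def Deep {W ι : Type*} (o : W → Option ι) (f : ι → W) : ℕ → ι → Prop
  | 0, _ => True
  | t + 1, i => ∃ j, o (f i) = some j ∧ Deep o f t j

lemma Decomp.near_of_not_deep {W ι : Type*} [Finite W] {H : SimpleGraph W} {o : W → Option ι}
    {f : ι → W} (h : Decomp H o f) : ∀ t i, ¬ Deep o f t i →
      Near H t (blockOf o f (some i)) {v | o v = none}
  | 0, _, hi => absurd trivial hi
  | t + 1, i, hi => by
    cases hf : o (f i) with
    | none =>
      have hr : IsBlockSet H {v | o v = none} := h.isBlockSet_iff.2 ⟨none, rfl⟩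
      exact ⟨_, hr, ⟨f i, Or.inl rfl, hf⟩, near_self hr t⟩
    | some j =>
      refine ⟨_, h.isBlockSet_iff.2 ⟨some j, rfl⟩, ⟨f i, Or.inl rfl, Or.inr hf⟩,
        h.near_of_not_deep t j fun hj => hi ⟨j, hf, hj⟩⟩

/-! ### Elementary symmetric sums -/

/-- The elementary symmetric sum of degree `t` of the numbers `a j`, `j ∈ A`. -/
def elemSymm {ι : Type*} (a : ι → ℝ) (A : Finset ι) (t : ℕ) : ℝ :=
  ∑ S ∈ A.powersetCard t, ∏ j ∈ S, a j

lemma elemSymm_congr {ι : Type*} {a b : ι → ℝ} {A : Finset ι} (h : ∀ j ∈ A, a j = b j) (t : ℕ) :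
    elemSymm a A t = elemSymm b A t :=
  Finset.sum_congr rfl fun _ hS => Finset.prod_congr rfl fun j hj =>
    h j ((Finset.mem_powersetCard.1 hS).1 hj)

lemma elemSymm_succ {ι : Type*} [DecidableEq ι] (a : ι → ℝ) (A : Finset ι) (t : ℕ) :
    ((t : ℝ) + 1) * elemSymm a A (t + 1) = ∑ j ∈ A, a j * elemSymm a (A.erase j) t := by
  have h1 : ((t : ℝ) + 1) * elemSymm a A (t + 1) =
      ∑ S ∈ A.powersetCard (t + 1), ∑ _j ∈ S, ∏ k ∈ S, a k := by
    rw [elemSymm, Finset.mul_sum]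
    refine Finset.sum_congr rfl fun S hS => ?_
    rw [Finset.sum_const, (Finset.mem_powersetCard.1 hS).2, nsmul_eq_mul]
    push_cast
    ring
  rw [h1]
  simp only [elemSymm, Finset.mul_sum]
  rw [Finset.sum_sigma', Finset.sum_sigma']
  refine Finset.sum_bij' (fun x _ => ⟨x.2, x.1.erase x.2⟩) (fun x _ => ⟨insert x.1 x.2, x.1⟩)
    ?_ ?_ ?_ ?_ ?_
  · rintro ⟨S, j⟩ h
    simp only [Finset.mem_sigma, Finset.mem_powersetCard] at h ⊢
    refine ⟨h.1.1 h.2, Finset.erase_subset_erase _ h.1.1, ?_⟩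
    rw [Finset.card_erase_of_mem h.2, h.1.2, Nat.add_sub_cancel]
  · rintro ⟨j, S⟩ h
    simp only [Finset.mem_sigma, Finset.mem_powersetCard] at h ⊢
    have hj : j ∉ S := fun hj => Finset.notMem_erase j A (h.2.1 hj)
    refine ⟨⟨Finset.insert_subset h.1 (h.2.1.trans (Finset.erase_subset _ _)), ?_⟩,
      Finset.mem_insert_self _ _⟩
    rw [Finset.card_insert_of_notMem hj, h.2.2]
  · rintro ⟨S, j⟩ h
    simp only [Finset.mem_sigma] at h
    simp [Finset.insert_erase h.2]
  · rintro ⟨j, S⟩ h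
    simp only [Finset.mem_sigma, Finset.mem_powersetCard] at h
    have hj : j ∉ S := fun hj => Finset.notMem_erase j A (h.2.1 hj)
    simp [Finset.erase_insert hj]
  · rintro ⟨S, j⟩ h
    simp only [Finset.mem_sigma] at h
    exact (Finset.mul_prod_erase S a h.2).symm

/-! ### Counting acyclic parent maps -/

section Counting

variable {W ι : Type*}

/-- The owner map after the part `i` has been merged into `x` (a part or the root). -/
def merge [DecidableEq ι] (o : W → Option ι) (i : ι) (x : Option ι) : W → Option ι :=
  fun v => if o v = some i then x else o v

lemma merge_ne [DecidableEq ι] {o : W → Option ι} {i : ι} {x : Option ι} (hx : x ≠ some i)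
    (v : W) : merge o i x v ≠ some i := by
  unfold merge
  split_ifs with h
  · exact hx
  · exact h

/-- Once the parent of part `i` is known, the part may be merged with the owner of its parent. -/
lemma acyclic_iff_merge [DecidableEq ι] {o : W → Option ι} {f : ι → W} {i : ι} :
    Acyclic o f ↔ o (f i) ≠ some i ∧ Acyclic (merge o i (o (f i))) f := by
  constructor
  · intro h
    refine ⟨h.ne_self i, ?_⟩
    obtain ⟨r, hr⟩ := h
    refine ⟨r, fun k j hkj => ?_⟩
    unfold merge at hkj
    split_ifs at hkj with h1
    · exact (hr i j hkj).trans (hr k i h1)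
    · exact hr k j hkj
  · rintro ⟨hi, r, hr⟩
    refine ⟨fun k => if k = i then (o (f i)).elim 1 fun j => 2 * r j + 3 else 2 * r k + 2,
      fun k j hkj => ?_⟩
    have hkj' : merge o i (o (f i)) (f k) = if j = i then o (f i) else some j := by
      simp only [merge, hkj, Option.some.injEq]
    by_cases hki : k = i
    · subst hki
      have hjk : j ≠ k := by rintro rfl; exact hi hkj
      simp [hkj, hjk]
    · by_cases hji : j = i
      · subst hji
        simp only [if_neg hki, if_true]
        rw [if_pos rfl] at hkj'
        cases ho : o (f j) with
        | none => simp
        | some l =>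
          have := hr k l (hkj'.trans ho)
          simp only [Option.elim_some]
          omega
      · rw [if_neg hji] at hkj'
        have := hr k j hkj'
        simp only [if_neg hki, if_neg hji]
        omega

/-- The parent of an empty part is irrelevant. -/
lemma Acyclic.update [DecidableEq ι] [Finite ι] {o : W → Option ι} {f : ι → W} (h : Acyclic o f)
    {i : ι} (hi : ∀ v, o v ≠ some i) (w : W) : Acyclic o (Function.update f i w) := by
  obtain ⟨r, hr⟩ := h
  have := Fintype.ofFinite ι
  refine ⟨Function.update r i (∑ j, r j + 1), fun k j hkj => ?_⟩
  have hji : j ≠ i := by rintro rfl; exact hi _ hkj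
  rw [Function.update_of_ne hji]
  by_cases hki : k = i
  · subst hki
    rw [Function.update_self]
    exact Nat.lt_succ_of_le (Finset.single_le_sum (fun _ _ => Nat.zero_le _) (Finset.mem_univ j))
  · rw [Function.update_of_ne hki] at hkj ⊢
    exact hr k j hkj

lemma Deep.update [DecidableEq ι] {o : W → Option ι} {f : ι → W} {i : ι} (hi : ∀ v, o v ≠ some i)
    (w : W) : ∀ t j, j ≠ i → Deep o f t j → Deep o (Function.update f i w) t j
  | 0, _, _, _ => trivial
  | t + 1, j, hj, ⟨k, hk, hd⟩ => by
    refine ⟨k, by rwa [Function.update_of_ne hj], Deep.update hi w t k ?_ hd⟩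
    rintro rfl
    exact hi _ hk

lemma Deep.merge [DecidableEq ι] {o : W → Option ι} {f : ι → W} {i : ι} {x : Option ι}
    {r : ι → ℕ} (hr : ∀ i j, o (f i) = some j → r j < r i) : ∀ t k, r k < r i →
    Deep o f t k → Deep (merge o i x) f t k
  | 0, _, _, _ => trivial
  | t + 1, k, hk, ⟨l, hl, hd⟩ => by
    have hlk := hr k l hl
    have hne : o (f k) ≠ some i := by
      intro h
      have := hr k i h
      omega
    exact ⟨l, by rw [BlockStable.merge, if_neg hne, hl], Deep.merge hr t l (hlk.trans hk) hd⟩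

variable [Fintype W] [Fintype ι]

lemma card_eq_sum_apply [DecidableEq W] [DecidableEq ι] (p : (ι → W) → Prop)
    [DecidablePred p] (i : ι) :
    ((Finset.univ.filter p).card : ℝ) =
      ∑ w : W, ((Finset.univ.filter fun f : ι → W => f i = w ∧ p f).card : ℝ) := by
  rw [← Nat.cast_sum]
  congr 1
  rw [Finset.card_eq_sum_card_fiberwise (f := fun f : ι → W => f i) (t := Finset.univ)
    (fun _ _ => Finset.mem_coe.2 (Finset.mem_univ _))]
  refine Finset.sum_congr rfl fun w' _ => ?_
  rw [Finset.filter_filter]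
  congr 1
  ext f
  simp [and_comm]

/-- A property that does not depend on the value at `i` is independent of that value. -/
lemma card_filter_apply_eq [DecidableEq W] [DecidableEq ι] (p : (ι → W) → Prop)
    [DecidablePred p] (i : ι)
    (hp : ∀ f w, p f → p (Function.update f i w)) (w : W) :
    (Fintype.card W : ℝ) * (Finset.univ.filter fun f : ι → W => f i = w ∧ p f).card =
      (Finset.univ.filter p).card := by
  have h2 : ∀ w' : W, (Finset.univ.filter fun f : ι → W => f i = w' ∧ p f).card =
      (Finset.univ.filter fun f : ι → W => f i = w ∧ p f).card := by
    intro w'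
    refine Finset.card_bij' (fun f _ => Function.update f i w) (fun f _ => Function.update f i w')
      ?_ ?_ ?_ ?_
    · intro f hf
      simp only [Finset.mem_filter_univ] at hf ⊢
      exact ⟨Function.update_self .., hp f w hf.2⟩
    · intro f hf
      simp only [Finset.mem_filter_univ] at hf ⊢
      exact ⟨Function.update_self .., hp f w' hf.2⟩
    · intro f hf
      simp only [Finset.mem_filter_univ] at hf
      rw [Function.update_idem, ← hf.1, Function.update_eq_self]
    · intro f hf
      simp only [Finset.mem_filter_univ] at hf
      rw [Function.update_idem, ← hf.1, Function.update_eq_self]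
  rw [card_eq_sum_apply p i]
  simp only [h2, Finset.sum_const, Finset.card_univ, nsmul_eq_mul]

open Classical in
/-- The number of vertices with owner `x`. -/
def ownerCard {W ι : Type*} [Fintype W] (o : W → Option ι) (x : Option ι) : ℝ :=
  (Finset.univ.filter fun v => o v = x).card

open Classical in
lemma card_eq_merge (o : W → Option ι) (i : ι) (w : W) :
    (Fintype.card W : ℝ) * (Finset.univ.filter fun f : ι → W => f i = w ∧ Acyclic o f).card =
      if o w = some i then 0 else ((Finset.univ.filter (Acyclic (merge o i (o w)))).card : ℝ) := by
  have hEq : (Finset.univ.filter fun f : ι → W => f i = w ∧ Acyclic o f) =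
      Finset.univ.filter fun f : ι → W =>
        f i = w ∧ (o w ≠ some i ∧ Acyclic (merge o i (o w)) f) := by
    ext f
    simp only [Finset.mem_filter_univ]
    refine and_congr_right fun hf => ?_
    rw [acyclic_iff_merge (i := i), hf]
  rw [hEq]
  split_ifs with h
  · simp [h]
  · rw [← card_filter_apply_eq (Acyclic (merge o i (o w))) i
      (fun f w' hf => hf.update (merge_ne h) w') w]
    simp [h]

open Classical in
lemma ownerCard_merge_none {W ι : Type*} [Fintype W] (o : W → Option ι) (i : ι) (x : Option ι) :
    ownerCard (merge o i x) none =
      ownerCard o none + if x = none then ownerCard o (some i) else 0 := by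
  simp only [ownerCard]
  split_ifs with h
  · subst h
    rw [← Nat.cast_add, ← Finset.card_union_of_disjoint]
    · congr 2
      ext v
      simp only [Finset.mem_filter_univ, Finset.mem_union]
      by_cases hv : o v = some i <;> simp [merge, hv]
    · rw [Finset.disjoint_filter]
      intro v _ h1 h2
      rw [h1] at h2; cases h2
  · rw [add_zero]
    congr 2
    ext v
    simp only [Finset.mem_filter_univ]
    by_cases hv : o v = some i <;> simp [merge, hv, h]

open Classical in
lemma sum_ite_eq_ownerCard {W ι : Type*} [Fintype W] (o : W → Option ι) (x : Option ι) (c : ℝ) :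
    ∑ w : W, (if o w = x then c else 0) = ownerCard o x * c := by
  rw [← Finset.sum_filter, Finset.sum_const, nsmul_eq_mul, ownerCard]

open Classical in
/-- A uniformly random parent map is acyclic with probability `s / n`, where `s` is the number of
root vertices and `n` the number of all vertices. -/
theorem card_acyclic (o : W → Option ι) :
    (Fintype.card W : ℝ) * (Finset.univ.filter (Acyclic o)).card =
      ownerCard o none * (Fintype.card W : ℝ) ^ Fintype.card ι := by
  induction hn : (Finset.univ.filter fun i => ∃ v, o v = some i).card using
    Nat.strong_induction_on generalizing o with
  | _ m ih =>
  by_cases hne : ∃ i v, o v = some i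
  · obtain ⟨i, v, hv⟩ := hne
    have hpos : (0 : ℝ) < Fintype.card W := by
      exact_mod_cast Fintype.card_pos_iff.2 ⟨v⟩
    have hstep : ∀ w, o w ≠ some i → (Fintype.card W : ℝ) *
        (Finset.univ.filter (Acyclic (merge o i (o w)))).card =
        ownerCard (merge o i (o w)) none * (Fintype.card W : ℝ) ^ Fintype.card ι := by
      intro w hw
      refine ih _ ?_ _ rfl
      rw [← hn]
      refine Finset.card_lt_card ?_
      rw [Finset.ssubset_iff_of_subset]
      · refine ⟨i, by simpa using ⟨v, hv⟩, ?_⟩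
        simp only [Finset.mem_filter_univ, not_exists]
        exact merge_ne hw
      · intro j hj
        simp only [Finset.mem_filter_univ] at hj ⊢
        obtain ⟨u, hu⟩ := hj
        unfold merge at hu
        split_ifs at hu with h1
        · exact ⟨w, hu⟩
        · exact ⟨u, hu⟩
    have htot : (Fintype.card W : ℝ) * ((Fintype.card W : ℝ) *
        (Finset.univ.filter (Acyclic o)).card) =
        ∑ w : W, (ownerCard o none - (if o w = some i then ownerCard o none else 0) +
          (if o w = none then ownerCard o (some i) else 0)) *
            (Fintype.card W : ℝ) ^ Fintype.card ι := by
      rw [card_eq_sum_apply _ i, Finset.mul_sum, Finset.mul_sum]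
      refine Finset.sum_congr rfl fun w _ => ?_
      rw [card_eq_merge]
      by_cases hw : o w = some i
      · simp [hw]
      · rw [if_neg hw, hstep w hw, ownerCard_merge_none, if_neg hw, sub_zero]
    rw [← Finset.sum_mul, Finset.sum_add_distrib, Finset.sum_sub_distrib, sum_ite_eq_ownerCard,
      sum_ite_eq_ownerCard, Finset.sum_const, Finset.card_univ, nsmul_eq_mul] at htot
    refine mul_left_cancel₀ hpos.ne' ?_
    rw [htot]
    ring
  · have hno : ∀ v, o v = none := by
      intro v
      rw [Option.eq_none_iff_forall_ne_some]
      exact fun i hi => hne ⟨i, v, hi⟩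
    have h1 : Finset.univ.filter (Acyclic o : (ι → W) → Prop) = Finset.univ := by
      ext f
      simp only [Finset.mem_filter_univ, Finset.mem_univ, iff_true]
      exact ⟨fun _ => 0, fun i j hij => by simp [hno] at hij⟩
    rw [h1, Finset.card_univ, Fintype.card_fun, ownerCard]
    simp [hno]

open Classical in
/-- The number of acyclic parent maps for which part `i` has depth more than `t`. Revealing the
parents of the successive parts on the way to the root and merging them, the count is reduced to the
probability that `t` independent uniform vertices lie in distinct parts. -/
theorem card_deep_le (o : W → Option ι) (t : ℕ) (i : ι) (A : Finset ι) (hi : i ∉ A)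
    (hA : ∀ v j, o v = some j → j = i ∨ j ∈ A) :
    (Fintype.card W : ℝ) ^ (t + 1) *
      (Finset.univ.filter fun f : ι → W => Acyclic o f ∧ Deep o f t i).card ≤
      ownerCard o none * (Fintype.card W : ℝ) ^ Fintype.card ι *
        ((t.factorial : ℝ) * elemSymm (fun j => ownerCard o (some j)) A t) := by
  induction t generalizing o i A with
  | zero =>
    have := card_acyclic o
    simp only [Deep, and_true, zero_add, pow_one, Nat.factorial_zero, Nat.cast_one, one_mul]
    rw [this]
    simp [elemSymm]
  | succ t ih =>
    set n : ℝ := (Fintype.card W : ℝ) with hn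
    have hbound : ∀ w : W, n ^ (t + 1) * (n * ((Finset.univ.filter fun f : ι → W => f i = w ∧
        (Acyclic o f ∧ Deep o f (t + 1) i)).card : ℝ)) ≤
        ∑ j ∈ A, if o w = some j then ownerCard o none * n ^ Fintype.card ι *
          ((t.factorial : ℝ) * elemSymm (fun j => ownerCard o (some j)) (A.erase j) t) else 0 := by
      intro w
      by_cases hw : ∃ j ∈ A, o w = some j
      · obtain ⟨j, hjA, hj⟩ := hw
        have hji : j ≠ i := by rintro rfl; exact hi hjA
        have hji' : (some j : Option ι) ≠ some i := by simpa using hji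
        rw [Finset.sum_eq_single_of_mem j hjA (fun k _ hk => if_neg (by
          rw [hj]; simpa using hk.symm)), if_pos hj]
        set o' := merge o i (some j) with ho'
        have hsub : (Finset.univ.filter fun f : ι → W => f i = w ∧
            (Acyclic o f ∧ Deep o f (t + 1) i)) ⊆
            Finset.univ.filter fun f : ι → W => f i = w ∧ (Acyclic o' f ∧ Deep o' f t j) := by
          intro f hf
          simp only [Finset.mem_filter_univ] at hf ⊢
          obtain ⟨hfw, hac, k, hk, hd⟩ := hf
          rw [hfw, hj, Option.some.injEq] at hk
          subst hk
          have hac' := (acyclic_iff_merge (i := i)).1 hac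
          rw [hfw, hj] at hac'
          obtain ⟨r, hr⟩ := hac
          exact ⟨hfw, hac'.2, hd.merge hr t _ (hr i _ (by rw [hfw, hj]))⟩
        have h1 : n * ((Finset.univ.filter fun f : ι → W => f i = w ∧
            (Acyclic o f ∧ Deep o f (t + 1) i)).card : ℝ) ≤
            ((Finset.univ.filter fun f : ι → W => Acyclic o' f ∧ Deep o' f t j).card : ℝ) := by
          rw [← card_filter_apply_eq (fun f => Acyclic o' f ∧ Deep o' f t j) i
            (fun f w' hf => ⟨hf.1.update (merge_ne hji') w',
              Deep.update (merge_ne hji') w' t j hji hf.2⟩) w]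
          exact mul_le_mul_of_nonneg_left (by exact_mod_cast Finset.card_le_card hsub)
            (Nat.cast_nonneg _)
        refine (mul_le_mul_of_nonneg_left h1 (by positivity)).trans ?_
        refine (ih o' j (A.erase j) (Finset.notMem_erase j A) ?_).trans_eq ?_
        · intro v k hk
          have hki : k ≠ i := by rintro rfl; exact merge_ne hji' v hk
          rw [ho', merge] at hk
          split_ifs at hk with h2
          · exact Or.inl (by simpa using hk.symm)
          · by_cases hkj : k = j
            · exact Or.inl hkj
            · exact Or.inr (Finset.mem_erase.2 ⟨hkj, (hA v k hk).resolve_left hki⟩)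
        · rw [ho', ownerCard_merge_none, if_neg (by simp), add_zero]
          congr 2
          refine elemSymm_congr (fun k hk => ?_) t
          rw [Finset.mem_erase] at hk
          have hki : k ≠ i := by rintro rfl; exact hi hk.2
          simp only [ownerCard]
          congr 2
          ext v
          simp only [Finset.mem_filter_univ]
          by_cases hv : o v = some i
          · simp [merge, hv, hk.1.symm, hki.symm]
          · simp [merge, hv]
      · have h0 : (Finset.univ.filter fun f : ι → W => f i = w ∧
            (Acyclic o f ∧ Deep o f (t + 1) i)) = ∅ := by
          ext f
          simp only [Finset.mem_filter_univ, Finset.notMem_empty, iff_false]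
          rintro ⟨hfw, hac, k, hk, -⟩
          refine hw ⟨k, (hA _ k hk).resolve_left ?_, hfw ▸ hk⟩
          rintro rfl
          exact hac.ne_self _ hk
        rw [h0, Finset.card_empty, Nat.cast_zero, mul_zero, mul_zero]
        refine Finset.sum_nonneg fun j hj => ?_
        rw [if_neg fun h => hw ⟨j, hj, h⟩]
    have hsum := Finset.sum_le_sum fun w (_ : w ∈ (Finset.univ : Finset W)) => hbound w
    rw [Finset.sum_comm] at hsum
    simp only [sum_ite_eq_ownerCard] at hsum
    rw [← Finset.mul_sum, ← Finset.mul_sum,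
      ← card_eq_sum_apply (fun f => Acyclic o f ∧ Deep o f (t + 1) i) i] at hsum
    calc _ = n ^ (t + 1) * (n * ((Finset.univ.filter fun f : ι → W =>
            Acyclic o f ∧ Deep o f (t + 1) i).card : ℝ)) := by ring
      _ ≤ _ := hsum
      _ = ownerCard o none * n ^ Fintype.card ι * (t.factorial *
            ∑ j ∈ A, ownerCard o (some j) *
              elemSymm (fun j => ownerCard o (some j)) (A.erase j) t) := by
          rw [Finset.mul_sum, Finset.mul_sum]
          exact Finset.sum_congr rfl fun j _ => by ring
      _ = _ := by
          rw [← elemSymm_succ, Nat.factorial_succ]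
          push_cast
          ring

end Counting

/-! ### A birthday bound -/

lemma factorial_mul_exp_le : ∀ t : ℕ, 1 ≤ t →
    (t.factorial : ℝ) * Real.exp t ≤ Real.exp 1 * (t : ℝ) ^ (t + 1) := by
  intro t ht
  induction t, ht using Nat.le_induction with
  | base => simp
  | succ t ht ih =>
    have htpos : (0 : ℝ) < t := by exact_mod_cast ht
    have h1 : Real.exp 1 * (t : ℝ) ^ (t + 1) ≤ ((t : ℝ) + 1) ^ (t + 1) := by
      have h2 : Real.exp (1 / ((t : ℝ) + 1)) * t ≤ t + 1 := by
        have h3 := Real.one_sub_le_exp_neg (1 / ((t : ℝ) + 1))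
        have h4 : 1 - 1 / ((t : ℝ) + 1) = t / (t + 1) := by field_simp; ring
        rw [h4, div_le_iff₀ (by positivity)] at h3
        calc Real.exp (1 / ((t : ℝ) + 1)) * t
            ≤ Real.exp (1 / ((t : ℝ) + 1)) * (Real.exp (-(1 / ((t : ℝ) + 1))) * (t + 1)) := by
              gcongr
          _ = t + 1 := by rw [← mul_assoc, ← Real.exp_add]; simp
      calc Real.exp 1 * (t : ℝ) ^ (t + 1) = (Real.exp (1 / ((t : ℝ) + 1)) * t) ^ (t + 1) := by
            rw [mul_pow, ← Real.exp_nat_mul]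
            congr 2
            push_cast
            field_simp
        _ ≤ _ := by gcongr
    calc ((t + 1).factorial : ℝ) * Real.exp ((t + 1 : ℕ) : ℝ)
        = Real.exp 1 * ((t : ℝ) + 1) * ((t.factorial : ℝ) * Real.exp t) := by
          rw [Nat.factorial_succ]
          push_cast
          rw [Real.exp_add]
          ring
      _ ≤ Real.exp 1 * ((t : ℝ) + 1) * (Real.exp 1 * (t : ℝ) ^ (t + 1)) := by gcongr
      _ ≤ Real.exp 1 * ((t : ℝ) + 1) * ((t : ℝ) + 1) ^ (t + 1) := by gcongr
      _ = _ := by push_cast; ring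

lemma neg_mul_log_le {u : ℝ} (hu : 0 < u) (hu1 : u ≤ 1) : -(u * Real.log u) ≤ (1 - u ^ 2) / 2 := by
  have h := Real.self_le_sinh_iff.2 (neg_nonneg.2 (Real.log_nonpos hu.le hu1))
  rw [Real.sinh_eq, neg_neg, Real.exp_neg, Real.exp_log hu] at h
  have h2 := mul_le_mul_of_nonneg_left h hu.le
  have h3 : u * ((u⁻¹ - u) / 2) = (1 - u ^ 2) / 2 := by field_simp
  rw [h3] at h2
  linarith

lemma elemSymm_mul_pow_le {ι : Type*} {a : ι → ℝ} (A : Finset ι) (ha : ∀ j ∈ A, 0 ≤ a j)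
    {x : ℝ} (hx : 0 ≤ x) (t : ℕ) : elemSymm a A t * x ^ t ≤ ∏ j ∈ A, (1 + a j * x) := by
  classical
  have h1 : elemSymm a A t * x ^ t = ∑ S ∈ A.powersetCard t, ∏ j ∈ S, (a j * x) := by
    rw [elemSymm, Finset.sum_mul]
    refine Finset.sum_congr rfl fun S hS => ?_
    rw [Finset.prod_mul_distrib, Finset.prod_const, (Finset.mem_powersetCard.1 hS).2]
  have h2 : ∏ j ∈ A, (1 + a j * x) = ∑ S ∈ A.powerset, ∏ j ∈ S, (a j * x) := by
    simp only [add_comm (1 : ℝ)]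
    rw [Finset.prod_add_one]
  rw [h1, h2]
  refine Finset.sum_le_sum_of_subset_of_nonneg (fun S hS => ?_) fun S hS _ => ?_
  · exact Finset.mem_powerset.2 (Finset.mem_powersetCard.1 hS).1
  · exact Finset.prod_nonneg fun j hj =>
      mul_nonneg (ha j (Finset.mem_powerset.1 hS hj)) hx

/-- The bound for the probability that a path of blocks goes on for `t` steps, when there are at most
`K` blocks. -/
def tailBound (K : ℝ) (t : ℕ) : ℝ := Real.exp 1 * t * Real.exp (-((t : ℝ) ^ 2 / (2 * K)))

lemma tailBound_nonneg (K : ℝ) (t : ℕ) : 0 ≤ tailBound K t := by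
  unfold tailBound; positivity

/-- The birthday bound: if `n` points are divided into fewer than `K` classes, then `t` independent
uniform points lie in distinct classes with probability at most `tailBound K t`. The symmetric
sum is bounded by the generating function `∏ (1 + a j * x)` at the optimal point `x`. -/
theorem factorial_mul_elemSymm_le {ι : Type*} {a : ι → ℝ} (A : Finset ι) (ha : ∀ j ∈ A, 0 ≤ a j)
    {n K : ℝ} (hn : 0 < n) (hsum : ∑ j ∈ A, a j ≤ n) (hK : (A.card : ℝ) < K) {t : ℕ} (ht : 1 ≤ t) :
    (t.factorial : ℝ) * elemSymm a A t ≤ tailBound K t * n ^ t := by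
  have htpos : (0 : ℝ) < t := by exact_mod_cast ht
  have hKpos : 0 < K := (Nat.cast_nonneg _).trans_lt hK
  by_cases htA : A.card < t
  · rw [elemSymm, Finset.powersetCard_eq_empty.2 htA, Finset.sum_empty, mul_zero]
    exact mul_nonneg (tailBound_nonneg K t) (by positivity)
  have htK : (t : ℝ) < K := lt_of_le_of_lt (by exact_mod_cast not_lt.1 htA) hK
  -- `u = 1 - t / K`, and `c = (1 - u) / u` is the optimal mean of `a j * x`
  set u : ℝ := 1 - t / K with hu
  have hu1 : u ≤ 1 := by rw [hu]; have : 0 ≤ (t : ℝ) / K := by positivity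
                         linarith
  have hu0 : 0 < u := by rw [hu, sub_pos, div_lt_one hKpos]; exact htK
  have htu : (t : ℝ) = K * (1 - u) := by rw [hu]; field_simp; ring
  set x : ℝ := t / (u * n) with hx
  have hx0 : 0 < x := by positivity
  have hprod : ∏ j ∈ A, (1 + a j * x) ≤ Real.exp (-(K * Real.log u)) := by
    have hfac : ∀ j ∈ A, 1 + a j * x ≤ Real.exp (-Real.log u + (a j * x * u - (1 - u))) := by
      intro j _
      rw [Real.exp_add, Real.exp_neg, Real.exp_log hu0]
      have := Real.add_one_le_exp (a j * x * u - (1 - u))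
      calc 1 + a j * x = u⁻¹ * (a j * x * u - (1 - u) + 1) := by field_simp; ring
        _ ≤ _ := by gcongr
    refine (Finset.prod_le_prod (fun j hj => ?_) hfac).trans ?_
    · have := ha j hj; positivity
    rw [← Real.exp_sum, Real.exp_le_exp, Finset.sum_add_distrib, Finset.sum_sub_distrib,
      Finset.sum_const, Finset.sum_const, nsmul_eq_mul, nsmul_eq_mul, ← Finset.sum_mul,
      ← Finset.sum_mul]
    have h1 : (∑ j ∈ A, a j) * x * u ≤ t := by
      calc (∑ j ∈ A, a j) * x * u ≤ n * x * u := by gcongr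
        _ = t := by rw [hx]; field_simp
    have h2 : Real.log u ≤ u - 1 := Real.log_le_sub_one_of_pos hu0
    have h3 : 0 ≤ (K - A.card) * (-Real.log u - (1 - u)) :=
      mul_nonneg (by linarith) (by linarith)
    nlinarith
  have hkey := (elemSymm_mul_pow_le A ha hx0.le t).trans hprod
  have hxt : elemSymm a A t ≤ Real.exp (-(K * Real.log u)) * (u ^ t * n ^ t / (t : ℝ) ^ t) := by
    rw [← le_div_iff₀ (by positivity)] at hkey
    refine hkey.trans_eq ?_
    rw [hx, div_pow, mul_pow]
    field_simp
  have hexp : Real.exp (-(K * Real.log u)) * u ^ t ≤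
      Real.exp t * Real.exp (-((t : ℝ) ^ 2 / (2 * K))) := by
    have hut : u ^ t = Real.exp (t * Real.log u) := by
      rw [Real.exp_nat_mul, Real.exp_log hu0]
    rw [hut, ← Real.exp_add, ← Real.exp_add, Real.exp_le_exp]
    have h1 := mul_le_mul_of_nonneg_left (neg_mul_log_le hu0 hu1) hKpos.le
    have h2 : (t : ℝ) ^ 2 / (2 * K) = K * (1 - u) ^ 2 / 2 := by
      rw [htu]; field_simp
    rw [h2, htu]
    nlinarith
  calc (t.factorial : ℝ) * elemSymm a A t
      ≤ t.factorial * (Real.exp (-(K * Real.log u)) * (u ^ t * n ^ t / (t : ℝ) ^ t)) := by gcongr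
    _ = t.factorial * (Real.exp (-(K * Real.log u)) * u ^ t) * (n ^ t / (t : ℝ) ^ t) := by ring
    _ ≤ t.factorial * (Real.exp t * Real.exp (-((t : ℝ) ^ 2 / (2 * K)))) *
          (n ^ t / (t : ℝ) ^ t) := by gcongr
    _ = (t.factorial * Real.exp t) * (Real.exp (-((t : ℝ) ^ 2 / (2 * K))) *
          (n ^ t / (t : ℝ) ^ t)) := by ring
    _ ≤ (Real.exp 1 * (t : ℝ) ^ (t + 1)) * (Real.exp (-((t : ℝ) ^ 2 / (2 * K))) *
          (n ^ t / (t : ℝ) ^ t)) :=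
        mul_le_mul_of_nonneg_right (factorial_mul_exp_le t ht) (by positivity)
    _ = tailBound K t * n ^ t := by
        rw [tailBound, pow_succ]
        field_simp

open Classical in
/-- A uniformly random acyclic parent map gives a fixed part depth more than `t` with probability at
most `tailBound K t`. -/
theorem card_deep_le_tailBound {W ι : Type*} [Fintype W] [Nonempty W] [Fintype ι]
    (o : W → Option ι) {K : ℝ} (hK : (Fintype.card ι : ℝ) ≤ K) {t : ℕ} (ht : 1 ≤ t) (i : ι) :
    ((Finset.univ.filter fun f : ι → W => Acyclic o f ∧ Deep o f t i).card : ℝ) ≤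
      tailBound K t * (Finset.univ.filter (Acyclic o)).card := by
  set n : ℝ := (Fintype.card W : ℝ) with hn
  have hnpos : 0 < n := by
    rw [hn]
    exact_mod_cast Fintype.card_pos (α := W)
  have h1 := card_deep_le o t i (Finset.univ.erase i) (Finset.notMem_erase _ _) fun v j _ => by
    by_cases hj : j = i
    · exact Or.inl hj
    · exact Or.inr (Finset.mem_erase.2 ⟨hj, Finset.mem_univ _⟩)
  have h2 : (t.factorial : ℝ) *
      elemSymm (fun j => ownerCard o (some j)) (Finset.univ.erase i) t ≤ tailBound K t * n ^ t := by
    refine factorial_mul_elemSymm_le _ (fun _ _ => Nat.cast_nonneg _) hnpos ?_ ?_ ht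
    · have hdisj : ∑ j ∈ Finset.univ.erase i, (Finset.univ.filter fun v => o v = some j).card ≤
          Fintype.card W := by
        rw [← Finset.card_biUnion]
        · exact Finset.card_le_univ _
        · intro j _ k _ hjk
          rw [Function.onFun, Finset.disjoint_filter]
          intro v _ h3 h4
          rw [h3, Option.some.injEq] at h4
          exact hjk h4
      have h3 : (∑ j ∈ Finset.univ.erase i, ownerCard o (some j)) ≤ n := by
        simp only [ownerCard]
        rw [hn]
        exact_mod_cast hdisj
      exact h3
    · refine lt_of_lt_of_le ?_ hK
      exact_mod_cast Finset.card_erase_lt_of_mem (Finset.mem_univ i)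
  have h3 := card_acyclic o
  rw [← hn] at h1 h3
  have hs : 0 ≤ ownerCard o none * n ^ Fintype.card ι := by
    have : (0 : ℝ) ≤ ownerCard o none := Nat.cast_nonneg _
    positivity
  have h4 := h1.trans (mul_le_mul_of_nonneg_left h2 hs)
  rw [← h3] at h4
  have hpos : 0 < n ^ (t + 1) := by positivity
  refine le_of_mul_le_mul_left (h4.trans_eq ?_) hpos
  ring

/-! ### Averaging over classes, and connected graphs -/

open Classical in
/-- An inequality between sums over each class of an equivalence relation holds for the whole sums. -/
lemma sum_le_sum_of_classes {X : Type*} (s : Finset X) (r : X → X → Prop)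
    (hrefl : ∀ x ∈ s, r x x) (hsymm : ∀ x ∈ s, ∀ y ∈ s, r x y → r y x)
    (htrans : ∀ x ∈ s, ∀ y ∈ s, ∀ z ∈ s, r x y → r y z → r x z) (F g : X → ℝ)
    (h : ∀ x ∈ s, ∑ y ∈ s with r x y, F y ≤ ∑ y ∈ s with r x y, g y) :
    ∑ x ∈ s, F x ≤ ∑ x ∈ s, g x := by
  set N : X → ℝ := fun x => ((s.filter fun y => r x y).card : ℝ) with hN
  have hcls : ∀ x ∈ s, ∀ y ∈ s, r x y →
      (s.filter fun z => r x z) = s.filter fun z => r y z := by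
    intro x hx y hy hxy
    ext z
    simp only [Finset.mem_filter]
    exact and_congr_right fun hz => ⟨htrans y hy x hx z hz (hsymm x hx y hy hxy),
      htrans x hx y hy z hz hxy⟩
  have hpos : ∀ x ∈ s, 0 < N x := fun x hx => by
    have : 0 < (s.filter fun y => r x y).card :=
      Finset.card_pos.2 ⟨x, Finset.mem_filter.2 ⟨hx, hrefl x hx⟩⟩
    simp only [hN]
    exact_mod_cast this
  have key : ∀ F : X → ℝ, ∑ x ∈ s, F x = ∑ x ∈ s, (∑ y ∈ s with r x y, F y) / N x := by
    intro F
    have h1 : ∀ x ∈ s, F x = ∑ y ∈ s, if r x y then F x / N x else 0 := by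
      intro x hx
      rw [← Finset.sum_filter, Finset.sum_const, nsmul_eq_mul]
      have := (hpos x hx).ne'
      change F x = N x * (F x / N x)
      field_simp
    rw [Finset.sum_congr rfl h1, Finset.sum_comm]
    refine Finset.sum_congr rfl fun y hy => ?_
    rw [Finset.sum_div, Finset.sum_filter]
    refine Finset.sum_congr rfl fun x hx => ?_
    by_cases hxy : r x y
    · rw [if_pos hxy, if_pos (hsymm x hx y hy hxy)]
      simp only [hN]
      rw [hcls x hx y hy hxy]
    · rw [if_neg hxy, if_neg fun h' => hxy (hsymm y hy x hx h')]
  rw [key F, key g]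
  exact Finset.sum_le_sum fun x hx => div_le_div_of_nonneg_right (h x hx) (hpos x hx).le

/-- Some pair of blocks of `H` is not joined by a chain of `t` blocks. -/
def Far {V : Type*} (H : SimpleGraph V) (t : ℕ) : Prop :=
  ∃ P Q, IsBlockSet H P ∧ IsBlockSet H Q ∧ ¬ Near H t Q P

/-- `y` is obtained from the graph `x.1` with root block `x.2` by reattaching the other blocks. -/
def ReattachRel {W : Type*} (x y : SimpleGraph W × Set W) : Prop :=
  ∃ (m : ℕ) (o : W → Option (Fin m)) (f f' : Fin m → W), Decomp x.1 o f ∧ {v | o v = none} = x.2 ∧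
    Acyclic o f' ∧ y = (reattach x.1 o f f', x.2)

lemma reattachRel_iff {W : Type*} [Finite W] {x y : SimpleGraph W × Set W} {m : ℕ}
    {o : W → Option (Fin m)} {f : Fin m → W} (h : Decomp x.1 o f) (hP : {v | o v = none} = x.2) :
    ReattachRel x y ↔ ∃ f', Acyclic o f' ∧ (reattach x.1 o f f', x.2) = y := by
  constructor
  · rintro ⟨m', o', f₀, f', h', hP', hac, rfl⟩
    obtain ⟨σ, ho, hf⟩ := h.unique h' (hP.trans hP'.symm)
    refine ⟨fun i => f' (σ i), hac.relabel σ ho fun _ => rfl, ?_⟩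
    rw [reattach_relabel σ ho hf fun _ => rfl]
  · rintro ⟨f', hac, rfl⟩
    exact ⟨m, o, f, f', h, hP, hac, rfl⟩

lemma ReattachRel.symm {W : Type*} {x y : SimpleGraph W × Set W} (h : ReattachRel x y) :
    ReattachRel y x := by
  obtain ⟨m, o, f, f', hd, hP, hac, rfl⟩ := h
  refine ⟨m, o, f', f, hd.reattach hac, hP, hd.acyclic, ?_⟩
  rw [reattach_reattach hac, hd.reattach_self]

lemma ReattachRel.trans {W : Type*} [Finite W] {x y z : SimpleGraph W × Set W}
    (hxy : ReattachRel x y) (hyz : ReattachRel y z) : ReattachRel x z := by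
  obtain ⟨m, o, f, f', hd, hP, hac, rfl⟩ := hxy
  obtain ⟨f'', hac', rfl⟩ := (reattachRel_iff (x := (reattach x.1 o f f', x.2))
    (hd.reattach hac) hP).1 hyz
  exact ⟨m, o, f, f'', hd, hP, hac', by rw [reattach_reattach hac]⟩

lemma Decomp.numBlocks {W : Type*} [Finite W] {H : SimpleGraph W} {m : ℕ}
    {o : W → Option (Fin m)} {f : Fin m → W} (h : Decomp H o f) :
    BlockStable.numBlocks H = m + 1 := by
  rw [numBlocks_eq, ← Nat.card_congr h.equiv]
  simp

open Classical in
/-- The bound within the class of all graphs that arise by reattaching the non-root blocks. -/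
lemma sum_class_le {W : Type*} [Fintype W] {H : SimpleGraph W} {P : Set W} {m : ℕ}
    {o : W → Option (Fin m)} {f : Fin m → W} (h : Decomp H o f) (hP : {v | o v = none} = P)
    {K : ℝ} (hK : (BlockStable.numBlocks H : ℝ) ≤ K) {t : ℕ} (ht : 1 ≤ t) :
    ∑ y : SimpleGraph W × Set W with ReattachRel (H, P) y,
      (if ∃ Q, IsBlockSet y.1 Q ∧ ¬ Near y.1 t Q y.2 then (1 : ℝ) else 0) ≤
    ∑ y : SimpleGraph W × Set W with ReattachRel (H, P) y,
      (BlockStable.numBlocks y.1 : ℝ) * tailBound K t := by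
  have hne : Nonempty W := h.root.1.to_type
  have himage : (Finset.univ.filter fun y : SimpleGraph W × Set W => ReattachRel (H, P) y) =
      (Finset.univ.filter (Acyclic o)).image fun f' => (reattach H o f f', P) := by
    ext y
    simp only [Finset.mem_filter_univ, Finset.mem_image]
    exact reattachRel_iff (x := (H, P)) h hP
  have hinj : Set.InjOn (fun f' => (reattach H o f f', P))
      (Finset.univ.filter (Acyclic o) : Set (Fin m → W)) := by
    intro f₁ h₁ f₂ h₂ h12
    simp only [Finset.coe_filter, Finset.mem_univ, true_and, Set.mem_ofPred_eq] at h₁ h₂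
    exact h.reattach_injective h₁ h₂ (Prod.ext_iff.1 h12).1
  rw [himage, Finset.sum_image hinj, Finset.sum_image hinj]
  have hm : (Fintype.card (Fin m) : ℝ) ≤ K := by
    rw [h.numBlocks] at hK
    push_cast at hK
    rw [Fintype.card_fin]
    linarith
  calc _ ≤ ∑ f' : Fin m → W with Acyclic o f', ∑ i, if Deep o f' t i then (1 : ℝ) else 0 := by
        refine Finset.sum_le_sum fun f' hf' => ?_
        have hac : Acyclic o f' := (Finset.mem_filter.1 hf').2
        split_ifs with hfar
        · obtain ⟨Q, hQ, hnear⟩ := hfar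
          have hd := h.reattach hac
          obtain ⟨x, rfl⟩ := hd.isBlockSet_iff.1 hQ
          cases x with
          | none =>
            refine absurd ?_ hnear
            change Near _ t {v | o v = none} P
            rw [hP]
            exact near_self (hP ▸ hQ) t
          | some i =>
            have hdeep : Deep o f' t i := by
              by_contra hi
              exact hnear (hP ▸ hd.near_of_not_deep t i hi)
            have := Finset.single_le_sum (f := fun i => if Deep o f' t i then (1 : ℝ) else 0)
              (fun i _ => by split_ifs <;> norm_num) (Finset.mem_univ i)
            simpa [hdeep] using this
        · exact Finset.sum_nonneg fun i _ => by split_ifs <;> norm_num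
    _ = ∑ i, ((Finset.univ.filter fun f' : Fin m → W => Acyclic o f' ∧ Deep o f' t i).card : ℝ) := by
        rw [Finset.sum_comm]
        refine Finset.sum_congr rfl fun i _ => ?_
        rw [Finset.sum_boole, Finset.filter_filter]
    _ ≤ ∑ _i : Fin m, tailBound K t * (Finset.univ.filter (Acyclic o)).card :=
        Finset.sum_le_sum fun i _ => by
          have := card_deep_le_tailBound o hm ht i
          have hinst : (fun a b : Fin m => Classical.propDecidable (a = b)) =
            instDecidableEqFin m := Subsingleton.elim _ _
          rw [hinst] at this
          exact this
    _ = ∑ f' : Fin m → W with Acyclic o f', (m : ℝ) * tailBound K t := by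
        simp only [Finset.sum_const, Finset.card_univ, Fintype.card_fin, nsmul_eq_mul]
        ring
    _ ≤ _ := by
        refine Finset.sum_le_sum fun f' hf' => ?_
        rw [(h.reattach (Finset.mem_filter.1 hf').2).numBlocks]
        have := tailBound_nonneg K t
        push_cast
        nlinarith

open Classical in
/-- In a family of connected graphs that is determined by numbers of blocks, few graphs have
blocks that are far apart. -/
theorem sum_far_le {W : Type*} [Fintype W] (E : Finset (SimpleGraph W))
    (hconn : ∀ H ∈ E, H.Preconnected)
    (hclosed : ∀ H ∈ E, ∀ H', H'.Preconnected → SameBlocks H H' → H' ∈ E)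
    {K : ℝ} (hK : ∀ H ∈ E, (BlockStable.numBlocks H : ℝ) ≤ K) {t : ℕ} (ht : 1 ≤ t) :
    ∑ H ∈ E, (if Far H t then (1 : ℝ) else 0) ≤
      ∑ H ∈ E, (BlockStable.numBlocks H : ℝ) ^ 2 * tailBound K t := by
  set X : Finset (SimpleGraph W × Set W) :=
    Finset.univ.filter fun x => x.1 ∈ E ∧ IsBlockSet x.1 x.2 with hX
  have hsumX : ∀ F : SimpleGraph W × Set W → ℝ,
      ∑ x ∈ X, F x = ∑ H ∈ E, ∑ P : Set W with IsBlockSet H P, F (H, P) := by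
    intro F
    rw [Finset.sum_sigma']
    refine Finset.sum_bij' (fun x _ => ⟨x.1, x.2⟩) (fun x _ => (x.1, x.2)) ?_ ?_ ?_ ?_ ?_ <;>
      simp [hX]
  have hsubX : ∀ x ∈ X, ∀ y, ReattachRel x y → y ∈ X := by
    rintro x hx _ ⟨m, o, f, f', hd, hP, hac, rfl⟩
    simp only [hX, Finset.mem_filter_univ] at hx ⊢
    have hd' := hd.reattach hac
    exact ⟨hclosed _ hx.1 _ hd'.preconnected (hd.sameBlocks_reattach hac),
      hd'.isBlockSet_iff.2 ⟨none, hP⟩⟩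
  have hclass : ∀ x ∈ X, (X.filter fun y => ReattachRel x y) =
      Finset.univ.filter fun y => ReattachRel x y := by
    intro x hx
    ext y
    simp only [Finset.mem_filter, Finset.mem_univ, true_and]
    exact ⟨fun h => h.2, fun h => ⟨hsubX x hx y h, h⟩⟩
  have hdec : ∀ x ∈ X, ∃ (m : ℕ) (o : W → Option (Fin m)) (f : Fin m → W),
      Decomp x.1 o f ∧ {v | o v = none} = x.2 := by
    intro x hx
    simp only [hX, Finset.mem_filter_univ] at hx
    exact exists_decomp (hconn _ hx.1) hx.2
  have hmain := sum_le_sum_of_classes X ReattachRel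
    (fun x hx => by
      obtain ⟨m, o, f, hd, hP⟩ := hdec x hx
      exact ⟨m, o, f, f, hd, hP, hd.acyclic, by rw [hd.reattach_self]⟩)
    (fun x _ y _ h => h.symm) (fun x _ y _ z _ h h' => h.trans h')
    (fun y => if ∃ Q, IsBlockSet y.1 Q ∧ ¬ Near y.1 t Q y.2 then (1 : ℝ) else 0)
    (fun y => (BlockStable.numBlocks y.1 : ℝ) * tailBound K t) (fun x hx => by
      rw [hclass x hx]
      obtain ⟨m, o, f, hd, hP⟩ := hdec x hx
      have hxE : x.1 ∈ E := by
        simp only [hX, Finset.mem_filter_univ] at hx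
        exact hx.1
      exact sum_class_le hd hP (hK _ hxE) ht)
  rw [hsumX, hsumX] at hmain
  refine le_trans (Finset.sum_le_sum fun H _ => ?_) (hmain.trans_eq (Finset.sum_congr rfl
    fun H _ => ?_))
  · split_ifs with hfar
    · obtain ⟨P, Q, hP, hQ, hn⟩ := hfar
      have := Finset.single_le_sum (s := Finset.univ.filter fun P : Set W => IsBlockSet H P)
        (f := fun P => if ∃ Q, IsBlockSet H Q ∧ ¬ Near H t Q P then (1 : ℝ) else 0)
        (fun i _ => by split_ifs <;> norm_num) (Finset.mem_filter.2 ⟨Finset.mem_univ P, hP⟩)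
      rwa [if_pos ⟨Q, hQ, hn⟩] at this
    · exact Finset.sum_nonneg fun i _ => by split_ifs <;> norm_num
  · have hcard : BlockStable.numBlocks H =
        (Finset.univ.filter fun P : Set W => IsBlockSet H P).card := by
      rw [numBlocks_eq, Nat.card_eq_fintype_card, Fintype.card_subtype]
    refine (Finset.sum_const ((BlockStable.numBlocks H : ℝ) * tailBound K t)).trans ?_
    rw [← hcard, nsmul_eq_mul]
    ring

/-! ### Components -/

/-- `C` is the vertex set of a component of `G`. -/
def IsComponent {V : Type*} (G : SimpleGraph V) (C : Set V) : Prop :=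
  ∃ c : G.ConnectedComponent, c.supp = C

lemma preconnected_induce_iff {V : Type*} {G : SimpleGraph V} {C : Set V} :
    (G.induce C).Preconnected ↔ ConnectsOn G.Adj C := by
  constructor
  · intro h a ha b hb
    have := (SimpleGraph.reachable_iff_reflTransGen _ _).1 (h ⟨a, ha⟩ ⟨b, hb⟩)
    exact this.lift Subtype.val fun x y hxy => ⟨hxy, x.2, y.2⟩
  · intro h a b
    rw [SimpleGraph.reachable_iff_reflTransGen]
    have h' : ConnectsOn G.Adj (Subtype.val '' (Set.univ : Set C)) := by simpa using h
    exact (h'.preimage_val a trivial b trivial).lift id fun x y hxy => hxy.1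

lemma IsComponent.adj_mem {V : Type*} {G : SimpleGraph V} {C : Set V} (h : IsComponent G C)
    {u v : V} (hu : u ∈ C) (huv : G.Adj u v) : v ∈ C := by
  obtain ⟨c, rfl⟩ := h
  rw [SimpleGraph.ConnectedComponent.mem_supp_iff] at hu ⊢
  rw [← hu]
  exact SimpleGraph.ConnectedComponent.sound huv.symm.reachable

lemma IsComponent.preconnected {V : Type*} {G : SimpleGraph V} {C : Set V} (h : IsComponent G C) :
    (G.induce C).Preconnected := by
  obtain ⟨c, rfl⟩ := h
  exact c.connected_toSimpleGraph.preconnected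

lemma IsComponent.mem_of_reflTransGen {V : Type*} {G : SimpleGraph V} {C U : Set V}
    (h : IsComponent G C) {u v : V} (hu : u ∈ C)
    (huv : Relation.ReflTransGen (fun x y => G.Adj x y ∧ x ∈ U ∧ y ∈ U) u v) : v ∈ C := by
  induction huv with
  | refl => exact hu
  | tail _ hxy ih => exact h.adj_mem ih hxy.1

lemma isComponent_of {V : Type*} {G : SimpleGraph V} {C : Set V} (hne : C.Nonempty)
    (hconn : (G.induce C).Preconnected) (hadj : ∀ u ∈ C, ∀ v, G.Adj u v → v ∈ C) :
    IsComponent G C := by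
  obtain ⟨a, ha⟩ := hne
  refine ⟨G.connectedComponentMk a, ?_⟩
  ext v
  rw [SimpleGraph.ConnectedComponent.mem_supp_iff, SimpleGraph.ConnectedComponent.eq]
  constructor
  · intro h
    have h' := (SimpleGraph.reachable_iff_reflTransGen _ _).1 h.symm
    clear h
    induction h' with
    | refl => exact ha
    | tail _ hxy ih => exact hadj _ ih _ hxy
  · exact fun hv => reachable_of_connectsOn (preconnected_induce_iff.1 hconn) hv ha

lemma IsComponent.eq_of_mem {V : Type*} {G : SimpleGraph V} {C C' : Set V} (h : IsComponent G C)
    (h' : IsComponent G C') {v : V} (hv : v ∈ C) (hv' : v ∈ C') : C = C' := by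
  obtain ⟨c, rfl⟩ := h
  obtain ⟨c', rfl⟩ := h'
  rw [SimpleGraph.ConnectedComponent.mem_supp_iff] at hv hv'
  rw [← hv, ← hv']

lemma nonseparable_induce_iff {V : Type*} {G : SimpleGraph V} {C : Set V} {U : Set C} :
    Nonseparable (G.induce C) U ↔ Nonseparable G (Subtype.val '' U) := by
  constructor
  · exact fun h => h.image Subtype.val Subtype.val_injective.injOn fun _ _ _ _ hxy => hxy
  · intro h
    refine ⟨Set.image_nonempty.1 h.1, h.2.1.preimage_val, fun v => ?_⟩
    have h2 := h.2.2 v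
    rw [← Set.image_singleton, ← Set.image_sdiff Subtype.val_injective] at h2
    exact h2.preimage_val

lemma IsComponent.isBlockSet_image {V : Type*} {G : SimpleGraph V} {C : Set V}
    (hC : IsComponent G C) {U : Set C} (hU : IsBlockSet (G.induce C) U) :
    IsBlockSet G (Subtype.val '' U) := by
  refine ⟨nonseparable_induce_iff.1 hU.1, fun U' hU' hs => ?_⟩
  obtain ⟨a, ha⟩ := hU.1.1
  have hsub : U' ⊆ C := fun v hv =>
    hC.mem_of_reflTransGen a.2 (hU'.2.1 a (hs ⟨a, ha, rfl⟩) v hv)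
  have him : Subtype.val '' (Subtype.val ⁻¹' U' : Set C) = U' := by
    rw [Subtype.image_preimage_coe, Set.inter_eq_right.2 hsub]
  have hns : Nonseparable (G.induce C) (Subtype.val ⁻¹' U') :=
    nonseparable_induce_iff.2 (by rw [him]; exact hU')
  have := hU.2 hns fun x hx => hs ⟨x, hx, rfl⟩
  rw [← him]
  exact Set.image_mono this

lemma IsComponent.exists_isBlockSet_image {V : Type*} {G : SimpleGraph V} {C B : Set V}
    (hC : IsComponent G C) (hB : IsBlockSet G B) {a : V} (ha : a ∈ B) (haC : a ∈ C) :
    ∃ U : Set C, IsBlockSet (G.induce C) U ∧ Subtype.val '' U = B := by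
  have hsub : B ⊆ C := fun v hv => hC.mem_of_reflTransGen haC (hB.1.2.1 a ha v hv)
  have him : Subtype.val '' (Subtype.val ⁻¹' B : Set C) = B := by
    rw [Subtype.image_preimage_coe, Set.inter_eq_right.2 hsub]
  refine ⟨Subtype.val ⁻¹' B, ⟨nonseparable_induce_iff.2 (by rw [him]; exact hB.1),
    fun U hU hs => ?_⟩, him⟩
  have h1 := hB.2 (nonseparable_induce_iff.1 hU) (by rw [← him]; exact Set.image_mono hs)
  exact fun x hx => h1 ⟨x, hx, rfl⟩

/-- The blocks of a graph are the blocks of its components. -/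
lemma bijective_blockSet_components {V : Type*} (G : SimpleGraph V) :
    Function.Bijective (fun x : (Σ C : {C : Set V // IsComponent G C}, BlockSet (G.induce C.1)) =>
      (⟨Subtype.val '' x.2.1, x.1.2.isBlockSet_image x.2.2⟩ : BlockSet G)) := by
  constructor
  · rintro ⟨⟨C, hC⟩, ⟨U, hU⟩⟩ ⟨⟨C', hC'⟩, ⟨U', hU'⟩⟩ h
    have h : Subtype.val '' U = Subtype.val '' U' := Subtype.ext_iff.1 h
    obtain ⟨a, ha⟩ := hU.1.1
    have ha' : (a : V) ∈ Subtype.val '' U' := h ▸ ⟨a, ha, rfl⟩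
    obtain ⟨b, -, hb⟩ := ha'
    obtain rfl : C = C' := hC.eq_of_mem hC' a.2 (hb ▸ b.2)
    obtain rfl : U = U' := Set.image_injective.2 Subtype.val_injective h
    rfl
  · rintro ⟨B, hB⟩
    obtain ⟨a, ha⟩ := hB.1.1
    have hC : IsComponent G (G.connectedComponentMk a).supp := ⟨_, rfl⟩
    obtain ⟨U, hU, rfl⟩ := hC.exists_isBlockSet_image hB ha rfl
    exact ⟨⟨⟨_, hC⟩, ⟨U, hU⟩⟩, rfl⟩

open Classical in
lemma numBlocks_eq_sum {V : Type*} [Fintype V] (G : SimpleGraph V) :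
    numBlocks G = ∑ C : Set V with IsComponent G C, numBlocks (G.induce C) := by
  rw [numBlocks_eq, ← Nat.card_congr (Equiv.ofBijective _ (bijective_blockSet_components G)),
    Nat.card_sigma]
  simp only [← numBlocks_eq]
  exact (Finset.sum_subtype _ (fun _ => by simp) fun C : Set V => numBlocks (G.induce C)).symm

lemma numBlocks_le_card_of_preconnected {W : Type*} [Finite W] {H : SimpleGraph W}
    (hH : H.Preconnected) : numBlocks H ≤ Nat.card W := by
  by_cases hne : Nonempty W
  · obtain ⟨w⟩ := hne
    obtain ⟨P, hP, -⟩ := exists_isBlockSet_superset (nonseparable_singleton H w)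
    obtain ⟨m, o, f, hd, -⟩ := exists_decomp hH hP
    have hsurj : Function.Surjective o := by
      intro x
      cases x with
      | none => exact hd.root.1
      | some i => exact hd.part_nonempty i
    have := Nat.card_le_card_of_surjective o hsurj
    rw [hd.numBlocks]
    simpa using this
  · rw [not_nonempty_iff] at hne
    have : IsEmpty (BlockSet H) := ⟨fun B => by
      obtain ⟨a, -⟩ := B.2.1.1
      exact hne.false a⟩
    rw [numBlocks_eq, Nat.card_of_isEmpty]
    exact Nat.zero_le _

/-- A graph has at most as many blocks as vertices. -/
theorem numBlocks_le_card {V : Type*} [Fintype V] (G : SimpleGraph V) :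
    numBlocks G ≤ Fintype.card V := by
  classical
  rw [numBlocks_eq_sum]
  calc _ ≤ ∑ C : Set V with IsComponent G C, C.toFinset.card := by
        refine Finset.sum_le_sum fun C hC => ?_
        have := numBlocks_le_card_of_preconnected (Finset.mem_filter.1 hC).2.preconnected
        rwa [Nat.card_eq_fintype_card, ← Set.toFinset_card] at this
    _ = ((Finset.univ.filter fun C : Set V => IsComponent G C).biUnion
          fun C => C.toFinset).card := by
        rw [Finset.card_biUnion]
        intro C hC C' hC' hne
        simp only [Finset.coe_filter, Finset.mem_univ, true_and] at hC hC'
        rw [Function.onFun, Set.disjoint_toFinset, Set.disjoint_left]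
        exact fun v hv hv' => hne (IsComponent.eq_of_mem hC hC' hv hv')
    _ ≤ _ := Finset.card_le_univ _

/-! ### The diameter of the block forest -/

lemma Near.image_val {V : Type*} {G : SimpleGraph V} {C : Set V} (hC : IsComponent G C) :
    ∀ {t : ℕ} {P Q : Set C}, Near (G.induce C) t P Q →
      Near G t (Subtype.val '' P) (Subtype.val '' Q)
  | 0, _, _, h => congrArg _ h
  | _ + 1, _, _, ⟨_, hR, ⟨a, ha⟩, h⟩ =>
    ⟨_, hC.isBlockSet_image hR, ⟨a, ⟨a, ha.1, rfl⟩, ⟨a, ha.2, rfl⟩⟩, Near.image_val hC h⟩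

lemma exists_walk_of_near {V : Type*} {G : SimpleGraph V} : ∀ {t : ℕ} {B B' : Block G},
    Near G t B.1.verts B'.1.verts →
      ∃ p : (blockForest G).Walk (Sum.inr B) (Sum.inr B'), p.length ≤ 2 * t
  | 0, B, B', h => by
    obtain rfl : B = B' := (blockEquiv G).injective (Subtype.ext h)
    exact ⟨.nil, by simp⟩
  | t + 1, B, B', ⟨R, hR, ⟨v, hv, hvR⟩, h⟩ => by
    set D : Block G := (blockEquiv G).symm ⟨R, hR⟩ with hD
    have hDR : D.1.verts = R := rfl
    obtain ⟨p, hp⟩ := exists_walk_of_near (B := D) (B' := B') (t := t) h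
    have h1 : (blockForest G).Adj (Sum.inr B) (Sum.inl v) := hv
    have h2 : (blockForest G).Adj (Sum.inl v) (Sum.inr D) := hvR
    refine ⟨.cons h1 (.cons h2 p), ?_⟩
    rw [SimpleGraph.Walk.length_cons, SimpleGraph.Walk.length_cons]
    omega

/-- The vertices of nodes of the block forest that are joined by a walk lie in one component. -/
lemma connectedComponent_eq_of_walk {V : Type*} {G : SimpleGraph V} {x y : V ⊕ Block G}
    (p : (blockForest G).Walk x y) : ∀ u v,
      (x = Sum.inl u ∨ ∃ B, x = Sum.inr B ∧ u ∈ B.1.verts) →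
      (y = Sum.inl v ∨ ∃ B, y = Sum.inr B ∧ v ∈ B.1.verts) → G.Reachable u v := by
  have hblock : ∀ (B : Block G), ∀ u ∈ B.1.verts, ∀ v ∈ B.1.verts, G.Reachable u v :=
    fun B u hu v hv => reachable_of_connectsOn B.2.isBlockSet.1.1.2.1 hu hv
  induction p with
  | @nil x =>
    rintro u v (rfl | ⟨B, rfl, hu⟩) (h | ⟨B', h, hv⟩)
    · cases h; exact SimpleGraph.Reachable.refl _
    · cases h
    · cases h
    · cases h; exact hblock B u hu v hv
  | @cons x y z h p ih =>
    rintro u v hx hz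
    match x, y, h with
    | Sum.inl a, Sum.inr B, h =>
      rcases hx with hx | ⟨B', hx, hu⟩
      · cases hx
        exact ih u v (Or.inr ⟨B, rfl, h⟩) hz
      · cases hx
    | Sum.inr B, Sum.inl a, h =>
      rcases hx with hx | ⟨B', hx, hu⟩
      · cases hx
      · cases hx
        exact (hblock B u hu a h).trans (ih a v (Or.inl rfl) hz)

lemma exists_block_near_node {V : Type*} [Finite V] {G : SimpleGraph V} (x : V ⊕ Block G) :
    ∃ (B : Block G) (v : V), v ∈ B.1.verts ∧
      (x = Sum.inl v ∨ ∃ B, x = Sum.inr B ∧ v ∈ B.1.verts) ∧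
      ∃ p : (blockForest G).Walk x (Sum.inr B), p.length ≤ 1 := by
  rcases x with v | B
  · obtain ⟨U, hU, hv⟩ := exists_isBlockSet_superset (nonseparable_singleton G v)
    have hv : v ∈ U := hv rfl
    have h1 : (blockForest G).Adj (Sum.inl v) (Sum.inr ((blockEquiv G).symm ⟨U, hU⟩)) := hv
    exact ⟨(blockEquiv G).symm ⟨U, hU⟩, v, hv, Or.inl rfl, .cons h1 .nil, by simp⟩
  · obtain ⟨v, hv⟩ := B.2.isBlockSet.1.1.1
    exact ⟨B, v, hv, Or.inr ⟨B, rfl, hv⟩, .nil, by simp⟩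

theorem diameter_blockForest_le {V : Type*} [Finite V] {G : SimpleGraph V} {t : ℕ}
    (h : ∀ C, IsComponent G C → ¬ Far (G.induce C) t) : diameter (blockForest G) ≤ 2 * t + 2 := by
  refine csSup_le' ?_
  rintro _ ⟨x, y, ⟨w⟩, rfl⟩
  obtain ⟨B, u, hu, hxu, p, hp⟩ := exists_block_near_node x
  obtain ⟨B', v, hv, hyv, q, hq⟩ := exists_block_near_node y
  have huv := connectedComponent_eq_of_walk w u v hxu hyv
  have hC : IsComponent G (G.connectedComponentMk v).supp := ⟨_, rfl⟩
  obtain ⟨U, hU, hUB⟩ := hC.exists_isBlockSet_image B.2.isBlockSet.1 hu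
    (SimpleGraph.ConnectedComponent.sound huv)
  obtain ⟨U', hU', hUB'⟩ := hC.exists_isBlockSet_image B'.2.isBlockSet.1 hv rfl
  have hnear : Near (G.induce (G.connectedComponentMk v).supp) t U U' := by
    by_contra hn
    exact h _ hC ⟨U', U, hU', hU, hn⟩
  have hnear' := hnear.image_val hC
  rw [hUB, hUB'] at hnear'
  obtain ⟨r, hr⟩ := exists_walk_of_near hnear'
  refine (SimpleGraph.dist_le (p.append (r.append q.reverse))).trans ?_
  simp only [SimpleGraph.Walk.length_append, SimpleGraph.Walk.length_reverse]
  omega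

/-! ### Changing one component -/

/-- The graph obtained from `G` by replacing the graph on `C` by `H`. -/
def replaceOn {V : Type*} (G : SimpleGraph V) (C : Set V) (H : SimpleGraph C) : SimpleGraph V where
  Adj u v := (∃ (hu : u ∈ C) (hv : v ∈ C), H.Adj ⟨u, hu⟩ ⟨v, hv⟩) ∨ (¬ (u ∈ C ∧ v ∈ C) ∧ G.Adj u v)
  symm := ⟨fun _ _ h => h.imp (fun ⟨hu, hv, h⟩ => ⟨hv, hu, h.symm⟩)
    fun ⟨h1, h2⟩ => ⟨fun h => h1 h.symm, h2.symm⟩⟩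
  loopless := ⟨fun _ h => h.elim (fun ⟨_, _, h⟩ => H.loopless.irrefl _ h)
    fun h => G.loopless.irrefl _ h.2⟩

/-- `G` and `G'` have the same edges outside `C`. -/
def AgreeOutside {V : Type*} (C : Set V) (G G' : SimpleGraph V) : Prop :=
  ∀ u v, ¬ (u ∈ C ∧ v ∈ C) → (G.Adj u v ↔ G'.Adj u v)

lemma agreeOutside_replaceOn {V : Type*} (G : SimpleGraph V) (C : Set V) (H : SimpleGraph C) :
    AgreeOutside C G (replaceOn G C H) := by
  intro u v h
  constructor
  · exact fun h' => Or.inr ⟨h, h'⟩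
  · rintro (⟨hu, hv, -⟩ | h')
    · exact absurd ⟨hu, hv⟩ h
    · exact h'.2

lemma induce_replaceOn {V : Type*} (G : SimpleGraph V) (C : Set V) (H : SimpleGraph C) :
    (replaceOn G C H).induce C = H := by
  ext u v
  constructor
  · rintro (⟨hu, hv, h⟩ | h)
    · exact h
    · exact absurd ⟨u.2, v.2⟩ h.1
  · exact fun h => Or.inl ⟨u.2, v.2, h⟩

lemma replaceOn_induce {V : Type*} {G G' : SimpleGraph V} {C : Set V} (h : AgreeOutside C G G') :
    replaceOn G C (G'.induce C) = G' := by
  ext u v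
  constructor
  · rintro (⟨hu, hv, h'⟩ | h')
    · exact h'
    · exact (h u v h'.1).1 h'.2
  · intro h'
    by_cases huv : u ∈ C ∧ v ∈ C
    · exact Or.inl ⟨huv.1, huv.2, h'⟩
    · exact Or.inr ⟨huv, (h u v huv).2 h'⟩

lemma AgreeOutside.symm {V : Type*} {C : Set V} {G G' : SimpleGraph V} (h : AgreeOutside C G G') :
    AgreeOutside C G' G := fun u v huv => (h u v huv).symm

lemma AgreeOutside.isComponent {V : Type*} {C : Set V} {G G' : SimpleGraph V}
    (h : AgreeOutside C G G') (hC : IsComponent G C) (hconn : (G'.induce C).Preconnected) :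
    IsComponent G' C := by
  have hne : C.Nonempty := by
    obtain ⟨c, rfl⟩ := hC
    exact c.nonempty_supp
  refine isComponent_of hne hconn fun u hu v huv => ?_
  by_contra hv
  exact hv (hC.adj_mem hu ((h u v fun h' => hv h'.2).2 huv))

lemma AgreeOutside.reachable {V : Type*} {C : Set V} {G G' : SimpleGraph V}
    (h : AgreeOutside C G G') (hconn : (G'.induce C).Preconnected) {u v : V}
    (huv : G.Reachable u v) : G'.Reachable u v := by
  obtain ⟨p⟩ := huv
  induction p with
  | nil => exact SimpleGraph.Reachable.refl _
  | @cons x y z hxy _ ih =>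
    refine SimpleGraph.Reachable.trans ?_ ih
    by_cases hC : x ∈ C ∧ y ∈ C
    · exact reachable_of_connectsOn (preconnected_induce_iff.1 hconn) hC.1 hC.2
    · exact ((h x y hC).1 hxy).reachable

/-- Replacing a component by a connected graph with the same blocks gives an equivalent graph. -/
theorem AgreeOutside.equivalent {V : Type*} {C : Set V} {G G' : SimpleGraph V}
    (h : AgreeOutside C G G') (hC : IsComponent G C) (hC' : IsComponent G' C)
    (hs : SameBlocks (G.induce C) (G'.induce C)) : Equivalent G G' := by
  have hreach : ∀ u v, G.Reachable u v ↔ G'.Reachable u v := fun u v =>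
    ⟨h.reachable hC'.preconnected, h.symm.reachable hC.preconnected⟩
  obtain ⟨e, he⟩ : ∃ e : G.ConnectedComponent ≃ G'.ConnectedComponent,
      ∀ a, e (G.connectedComponentMk a) = G'.connectedComponentMk a :=
    ⟨Quot.congrRight hreach, fun _ => rfl⟩
  refine ⟨e, fun c => ?_⟩
  have hsupp : (e c).supp = c.supp := by
    induction c using SimpleGraph.ConnectedComponent.ind with
    | h a =>
      ext v
      rw [he, SimpleGraph.ConnectedComponent.mem_supp_iff,
        SimpleGraph.ConnectedComponent.mem_supp_iff, SimpleGraph.ConnectedComponent.eq, SimpleGraph.ConnectedComponent.eq, hreach]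
  refine ⟨hsupp, ?_⟩
  have key : ∀ S : Set V, S = c.supp →
      SameBlocks (G.induce c.supp) (G'.induce S) := by
    rintro _ rfl
    by_cases hcC : c.supp = C
    · rw [hcC]; exact hs
    · have : G.induce c.supp = G'.induce c.supp := by
        ext u v
        refine h u v fun huv => hcC ?_
        exact IsComponent.eq_of_mem ⟨c, rfl⟩ hC u.2 huv.1
      rw [this]
      exact fun _ _ => rfl
  exact key _ hsupp

open Classical in
/-- In a weakly block-stable class, few graphs have a component with blocks that are far apart. -/
theorem card_far_le {A : GraphClass} (hA : A.WeaklyBlockStable) {n : ℕ} {K : ℝ}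
    (hK : ∀ G ∈ A.on n, (numBlocks G : ℝ) ≤ K) {t : ℕ} (ht : 1 ≤ t) :
    ((Finset.univ.filter fun G : SimpleGraph (Fin n) =>
      G ∈ A.on n ∧ ∃ C, IsComponent G C ∧ Far (G.induce C) t).card : ℝ) ≤
      K ^ 2 * tailBound K t * (Finset.univ.filter fun G => G ∈ A.on n).card := by
  set Y : Finset (SimpleGraph (Fin n) × Set (Fin n)) :=
    Finset.univ.filter fun x => x.1 ∈ A.on n ∧ IsComponent x.1 x.2 with hY
  have hsumY : ∀ F : SimpleGraph (Fin n) × Set (Fin n) → ℝ,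
      ∑ x ∈ Y, F x = ∑ G : SimpleGraph (Fin n) with G ∈ A.on n,
        ∑ C : Set (Fin n) with IsComponent G C, F (G, C) := by
    intro F
    rw [Finset.sum_sigma']
    refine Finset.sum_bij' (fun x _ => ⟨x.1, x.2⟩) (fun x _ => (x.1, x.2)) ?_ ?_ ?_ ?_ ?_ <;>
      simp [hY]
  have hsub : ∀ G : SimpleGraph (Fin n), (∑ C : Set (Fin n) with IsComponent G C,
      (numBlocks (G.induce C) : ℝ)) = numBlocks G := by
    intro G
    rw [numBlocks_eq_sum G]
    push_cast
    rfl
  have hle : ∀ x ∈ Y, (numBlocks (x.1.induce x.2) : ℝ) ≤ K := by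
    intro x hx
    simp only [hY, Finset.mem_filter_univ] at hx
    refine le_trans ?_ (hK _ hx.1)
    rw [← hsub x.1]
    exact Finset.single_le_sum (f := fun C => (numBlocks (x.1.induce C) : ℝ))
      (fun _ _ => Nat.cast_nonneg _) (Finset.mem_filter.2 ⟨Finset.mem_univ _, hx.2⟩)
  obtain ⟨r, hr⟩ : ∃ r : SimpleGraph (Fin n) × Set (Fin n) → SimpleGraph (Fin n) × Set (Fin n) →
      Prop, ∀ x y, r x y ↔ x.2 = y.2 ∧ AgreeOutside x.2 x.1 y.1 := ⟨_, fun _ _ => Iff.rfl⟩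
  have hmain := sum_le_sum_of_classes Y r
    (fun x _ => (hr x x).2 ⟨rfl, fun _ _ _ => Iff.rfl⟩)
    (fun x _ y _ h => by
      rw [hr] at h ⊢
      exact ⟨h.1.symm, h.1 ▸ h.2.symm⟩)
    (fun x _ y _ z _ h h' => by
      rw [hr] at h h' ⊢
      exact ⟨h.1.trans h'.1, fun u v huv => (h.2 u v huv).trans (h'.2 u v (h.1 ▸ huv))⟩)
    (fun x => if Far (x.1.induce x.2) t then (1 : ℝ) else 0)
    (fun x => (numBlocks (x.1.induce x.2) : ℝ) ^ 2 * tailBound K t) (by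
      rintro ⟨G, C⟩ hx
      simp only [hY, Finset.mem_filter_univ] at hx
      -- the class consists of the graphs obtained by placing a member of `E` on `C`
      set E : Finset (SimpleGraph C) := Finset.univ.filter fun H =>
        H.Preconnected ∧ replaceOn G C H ∈ A.on n with hE
      have hclass : (Y.filter fun y => r (G, C) y) =
          E.image fun H => (replaceOn G C H, C) := by
        ext ⟨G', C'⟩
        simp only [hY, hE, Finset.mem_filter, Finset.mem_univ, true_and, Finset.mem_image,
          Prod.mk.injEq, hr]
        constructor
        · rintro ⟨⟨hG', hC'⟩, rfl, hag⟩
          exact ⟨G'.induce C, ⟨hC'.preconnected, by rwa [replaceOn_induce hag]⟩,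
            replaceOn_induce hag, rfl⟩
        · rintro ⟨H, ⟨hH, hmem⟩, rfl, rfl⟩
          have hag := agreeOutside_replaceOn G C H
          exact ⟨⟨hmem, hag.isComponent hx.2 (by rwa [induce_replaceOn])⟩, rfl, hag⟩
      have hinj : Set.InjOn (fun H : SimpleGraph C => (replaceOn G C H, C)) E := by
        intro H _ H' _ hHH
        have h1 : replaceOn G C H = replaceOn G C H' := (Prod.ext_iff.1 hHH).1
        rw [← induce_replaceOn G C H, ← induce_replaceOn G C H', h1]
      have hmemY : ∀ H ∈ E, (replaceOn G C H, C) ∈ Y := by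
        intro H hH
        have : (replaceOn G C H, C) ∈ E.image fun H => (replaceOn G C H, C) :=
          Finset.mem_image_of_mem _ hH
        rw [← hclass] at this
        exact (Finset.mem_filter.1 this).1
      rw [hclass, Finset.sum_image hinj, Finset.sum_image hinj]
      simp only [induce_replaceOn]
      refine sum_far_le E (fun H hH => (Finset.mem_filter.1 hH).2.1) ?_ ?_ ht
      · intro H hH H' hconn hs
        have hcomp := (Finset.mem_filter.1 (hmemY H hH)).2.2
        refine Finset.mem_filter.2 ⟨Finset.mem_univ _, hconn, ?_⟩
        have hag' := agreeOutside_replaceOn G C H'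
        have hcomp' := hag'.isComponent hx.2 (by rwa [induce_replaceOn])
        refine hA (Fin n) (replaceOn G C H) _ (Finset.mem_filter.1 hH).2.2 ?_
        refine AgreeOutside.equivalent (C := C) (fun u v huv =>
          ((hag' u v huv).symm.trans (agreeOutside_replaceOn G C H u v huv))) hcomp' hcomp ?_
        rw [induce_replaceOn, induce_replaceOn]
        exact fun m K => (hs m K).symm
      · intro H hH
        have := hle _ (hmemY H hH)
        rwa [induce_replaceOn] at this)
  rw [hsumY, hsumY] at hmain
  calc _ = ∑ G : SimpleGraph (Fin n) with G ∈ A.on n,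
        if ∃ C, IsComponent G C ∧ Far (G.induce C) t then (1 : ℝ) else 0 := by
        rw [Finset.sum_boole, Finset.filter_filter]
    _ ≤ _ := Finset.sum_le_sum fun G _ => ?_
    _ ≤ _ := hmain
    _ ≤ ∑ G : SimpleGraph (Fin n) with G ∈ A.on n, K ^ 2 * tailBound K t := by
        refine Finset.sum_le_sum fun G hG => ?_
        rw [← Finset.sum_mul]
        refine mul_le_mul_of_nonneg_right ?_ (tailBound_nonneg K t)
        refine (Finset.sum_sq_le_sq_sum_of_nonneg fun _ _ => Nat.cast_nonneg _).trans ?_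
        rw [hsub]
        have := hK G (Finset.mem_filter.1 hG).2
        gcongr
    _ = _ := by rw [Finset.sum_const, nsmul_eq_mul]; ring
  split_ifs with hfar
  · obtain ⟨C, hC, hF⟩ := hfar
    have := Finset.single_le_sum (s := Finset.univ.filter fun C : Set (Fin n) => IsComponent G C)
      (f := fun C => if Far (G.induce C) t then (1 : ℝ) else 0)
      (fun i _ => by split_ifs <;> norm_num) (Finset.mem_filter.2 ⟨Finset.mem_univ C, hC⟩)
    rwa [if_pos hF] at this
  · exact Finset.sum_nonneg fun i _ => by split_ifs <;> norm_num

/-! ### Probabilities and asymptotics -/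

lemma GraphClass.prob_le_tailBound {A : GraphClass} (hA : A.WeaklyBlockStable) {n : ℕ}
    (hne : (A.on n).Nonempty) {K : ℝ} (hK : ∀ G ∈ A.on n, (numBlocks G : ℝ) ≤ K) {t : ℕ}
    (ht : 1 ≤ t) {P : SimpleGraph (Fin n) → Prop}
    (hP : ∀ G, P G → 2 * t + 2 < diameter (blockForest G)) :
    A.prob n P ≤ K ^ 2 * tailBound K t := by
  classical
  have hpos : (0 : ℝ) < (A.on n).ncard := by
    exact_mod_cast (Set.ncard_pos (Set.toFinite _)).2 hne
  rw [GraphClass.prob, div_le_iff₀ hpos]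
  have h1 : A.on n = ↑(Finset.univ.filter fun G : SimpleGraph (Fin n) => G ∈ A.on n) := by
    ext G; simp
  have h2 : {G ∈ A.on n | P G}.ncard ≤ (Finset.univ.filter fun G : SimpleGraph (Fin n) =>
      G ∈ A.on n ∧ ∃ C, IsComponent G C ∧ Far (G.induce C) t).card := by
    rw [← Set.ncard_coe_finset]
    refine Set.ncard_le_ncard (fun G hG => ?_) (Set.toFinite _)
    simp only [Finset.coe_filter, Finset.mem_univ, true_and]
    refine ⟨hG.1, ?_⟩
    by_contra hno
    push Not at hno
    exact absurd (diameter_blockForest_le hno) (not_le.2 (hP G hG.2))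
  have h3 : ((A.on n).ncard : ℝ) =
      (Finset.univ.filter fun G : SimpleGraph (Fin n) => G ∈ A.on n).card := by
    conv_lhs => rw [h1, Set.ncard_coe_finset]
  rw [h3]
  exact le_trans (by exact_mod_cast h2) (card_far_le hA hK ht)

lemma GraphClass.prob_add_prob_not {A : GraphClass} {n : ℕ} (hne : (A.on n).Nonempty)
    (P : SimpleGraph (Fin n) → Prop) : A.prob n P + A.prob n (fun G => ¬ P G) = 1 := by
  have hpos : (0 : ℝ) < (A.on n).ncard := by
    exact_mod_cast (Set.ncard_pos (Set.toFinite _)).2 hne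
  have h := Set.ncard_inter_add_ncard_sdiff_eq_ncard (A.on n) {G | P G} (Set.toFinite _)
  rw [GraphClass.prob, GraphClass.prob, ← add_div, div_eq_one_iff_eq hpos.ne']
  exact_mod_cast h

lemma GraphClass.prob_nonneg (A : GraphClass) (n : ℕ) (P : SimpleGraph (Fin n) → Prop) :
    0 ≤ A.prob n P := by
  unfold GraphClass.prob; positivity

/-- With the number of steps chosen just below `(5 / 2) * √(K log K)`, the bound for a pair of blocks
beats the number of pairs. -/
lemma eventually_tailBound_le : ∀ᶠ K : ℝ in atTop, ∃ t : ℕ, 1 ≤ t ∧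
    (2 * t + 2 : ℝ) ≤ 5 * Real.sqrt (K * Real.log K) ∧
    K ^ 2 * tailBound K t ≤ Real.exp (3 - Real.log K / 8) := by
  have hlog : ∀ᶠ K : ℝ in atTop, Real.log K ≤ (4 / 25) * K := by
    filter_upwards [Real.isLittleO_log_id_atTop.bound (show (0 : ℝ) < 4 / 25 by norm_num),
      eventually_ge_atTop 1] with K hK h1
    rw [Real.norm_eq_abs, id, Real.norm_eq_abs, abs_of_nonneg (Real.log_nonneg h1),
      abs_of_nonneg (by linarith)] at hK
    exact hK
  filter_upwards [hlog, eventually_ge_atTop 9,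
    Real.tendsto_log_atTop.eventually_ge_atTop 1] with K hlogK hK hlog1
  set s : ℝ := 5 / 2 * Real.sqrt (K * Real.log K) with hs
  have hKlog : 0 ≤ K * Real.log K := by positivity
  have hs2 : s ^ 2 = 25 / 4 * (K * Real.log K) := by
    rw [hs, mul_pow, Real.sq_sqrt hKlog]; norm_num
  have hs0 : 0 ≤ s := by positivity
  have hs3 : 3 ≤ s := by
    have : (3 : ℝ) ^ 2 ≤ s ^ 2 := by rw [hs2]; nlinarith
    exact le_of_sq_le_sq this hs0
  have hsK : s ≤ K := by
    have : s ^ 2 ≤ K ^ 2 := by rw [hs2]; nlinarith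
    exact le_of_sq_le_sq this (by linarith)
  obtain ⟨m, hm⟩ : ∃ m : ℕ, m = ⌊s⌋₊ := ⟨_, rfl⟩
  have hm1 : (m : ℝ) ≤ s := hm ▸ Nat.floor_le hs0
  have hm2 : s < m + 1 := hm ▸ Nat.lt_floor_add_one s
  have hm3 : 3 ≤ m := hm ▸ Nat.le_floor (by exact_mod_cast hs3)
  obtain ⟨t, rfl⟩ : ∃ t, m = t + 1 := ⟨m - 1, by omega⟩
  push_cast at hm1 hm2
  refine ⟨t, by omega, ?_, ?_⟩
  · have : 5 * Real.sqrt (K * Real.log K) = 2 * s := by rw [hs]; ring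
    rw [this]; linarith
  · have ht0 : (0 : ℝ) ≤ t := Nat.cast_nonneg t
    have hKpos : 0 < K := by linarith
    have hexp : -((t : ℝ) ^ 2 / (2 * K)) ≤ 2 - 25 / 8 * Real.log K := by
      have h1 : s ^ 2 - 4 * s ≤ (t : ℝ) ^ 2 := by nlinarith
      have h2 : (25 / 8 * Real.log K - 2) * (2 * K) ≤ (t : ℝ) ^ 2 := by
        rw [hs2] at h1; nlinarith
      rw [← le_div_iff₀ (by positivity)] at h2
      linarith
    have hK3 : K ^ 3 = Real.exp (3 * Real.log K) := by
      rw [show (3 : ℝ) = ((3 : ℕ) : ℝ) by norm_num, Real.exp_nat_mul, Real.exp_log hKpos]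
    calc K ^ 2 * tailBound K t
        = K ^ 2 * t * Real.exp 1 * Real.exp (-((t : ℝ) ^ 2 / (2 * K))) := by
          rw [tailBound]; ring
      _ ≤ K ^ 2 * K * Real.exp 1 * Real.exp (2 - 25 / 8 * Real.log K) := by
          have : (t : ℝ) ≤ K := by linarith
          gcongr
      _ = Real.exp (3 * Real.log K) * Real.exp 1 * Real.exp (2 - 25 / 8 * Real.log K) := by
          rw [← hK3]; ring
      _ = Real.exp (3 - Real.log K / 8) := by
          rw [← Real.exp_add, ← Real.exp_add]
          congr 1
          ring

/-- The diameter bound in terms of a bound on the number of blocks. -/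
theorem GraphClass.whp_diameter_le {A : GraphClass} (hA : A.WeaklyBlockStable) (k : ℕ → ℝ)
    (hk : ∀ n : ℕ, 1 ≤ n → ∀ G ∈ A.on n, (numBlocks G : ℝ) ≤ k n) (hlim : Tendsto k A.sizes atTop) :
    A.Whp (fun n R => (diameter (blockForest R) : ℝ) ≤ 5 * Real.sqrt (k n * Real.log (k n))) := by
  have hbound : ∀ᶠ n in A.sizes, 1 - Real.exp (3 - Real.log (k n) / 8) ≤
      A.prob n (fun R => (diameter (blockForest R) : ℝ) ≤
        5 * Real.sqrt (k n * Real.log (k n))) ∧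
      A.prob n (fun R => (diameter (blockForest R) : ℝ) ≤
        5 * Real.sqrt (k n * Real.log (k n))) ≤ 1 := by
    have hne : ∀ᶠ n in A.sizes, (A.on n).Nonempty :=
      (eventually_principal.2 fun _ h => h).filter_mono inf_le_right
    have h1 : ∀ᶠ n in A.sizes, 1 ≤ n := (eventually_ge_atTop 1).filter_mono inf_le_left
    filter_upwards [hlim.eventually eventually_tailBound_le, hne, h1] with n ⟨t, ht, h5, hle⟩ hne h1
    have hsum := GraphClass.prob_add_prob_not hne (fun R =>
      (diameter (blockForest R) : ℝ) ≤ 5 * Real.sqrt (k n * Real.log (k n)))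
    have hnot := GraphClass.prob_le_tailBound hA hne (hk n h1) ht
      (P := fun R => ¬ (diameter (blockForest R) : ℝ) ≤ 5 * Real.sqrt (k n * Real.log (k n)))
      (fun G hG => by
        have h6 := h5.trans_lt (not_le.1 hG)
        exact_mod_cast h6)
    have h0 := A.prob_nonneg n (fun R =>
      ¬ (diameter (blockForest R) : ℝ) ≤ 5 * Real.sqrt (k n * Real.log (k n)))
    constructor <;> linarith
  have hexp : Tendsto (fun n => 1 - Real.exp (3 - Real.log (k n) / 8)) A.sizes (𝓝 1) := by
    have h1 : Tendsto (fun n => Real.log (k n) / 8) A.sizes atTop :=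
      (Real.tendsto_log_atTop.comp hlim).atTop_div_const (by norm_num)
    have h2 : Tendsto (fun n => 3 - Real.log (k n) / 8) A.sizes atBot :=
      tendsto_atBot_add_const_left _ 3 (tendsto_neg_atTop_atBot.comp h1)
    simpa using (Real.tendsto_exp_atBot.comp h2).const_sub 1
  exact tendsto_of_tendsto_of_tendsto_of_le_of_le' hexp tendsto_const_nhds
    (hbound.mono fun _ h => h.1) (hbound.mono fun _ h => h.2)

/-- The exponential bound for linear diameters. -/
theorem GraphClass.exists_prob_diameter_ge_le {ε : ℝ} (hε : 0 < ε) :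
    ∃ c : ℝ, 0 < c ∧ ∃ N : ℕ, ∀ A : GraphClass, A.WeaklyBlockStable →
      ∀ n : ℕ, N ≤ n → (A.on n).Nonempty →
        A.prob n (fun R => ε * (n : ℝ) ≤ (diameter (blockForest R) : ℝ)) ≤
          Real.exp (-(c * (n : ℝ))) := by
  set c : ℝ := ε ^ 2 / 64 with hc
  have hcpos : 0 < c := by positivity
  have hpoly : ∀ᶠ n : ℕ in atTop,
      (c * n) ^ 3 * Real.exp (-(c * n)) ≤ c ^ 3 / (Real.exp 1 * ε) := by
    have h1 : Tendsto (fun n : ℕ => c * (n : ℝ)) atTop atTop :=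
      tendsto_natCast_atTop_atTop.const_mul_atTop hcpos
    have h2 := (Real.tendsto_pow_mul_exp_neg_atTop_nhds_zero 3).comp h1
    exact (h2.eventually_lt_const (show 0 < c ^ 3 / (Real.exp 1 * ε) by positivity)).mono
      fun _ h => h.le
  have hlarge : ∀ᶠ n : ℕ in atTop, 12 ≤ ε * (n : ℝ) :=
    (tendsto_natCast_atTop_atTop.const_mul_atTop hε).eventually_ge_atTop 12
  obtain ⟨N, hN⟩ := eventually_atTop.1 (hpoly.and hlarge)
  refine ⟨c, hcpos, N, fun A hA n hn hne => ?_⟩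
  obtain ⟨hpol, hlar⟩ := hN n hn
  have hnpos : (0 : ℝ) < n := by
    rcases (Nat.cast_nonneg n : (0 : ℝ) ≤ n).eq_or_lt with h | h
    · rw [← h] at hlar; norm_num at hlar
    · exact h
  obtain ⟨m, hm⟩ : ∃ m : ℕ, m = ⌈ε * (n : ℝ) / 2⌉₊ := ⟨_, rfl⟩
  have hm1 : ε * (n : ℝ) / 2 ≤ m := hm ▸ Nat.le_ceil _
  have hm2 : (m : ℝ) < ε * (n : ℝ) / 2 + 1 := hm ▸ Nat.ceil_lt_add_one (by positivity)
  have hm3 : 3 ≤ m := by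
    have : (3 : ℝ) ≤ m := by linarith
    exact_mod_cast this
  obtain ⟨t, rfl⟩ : ∃ t, m = t + 2 := ⟨m - 2, by omega⟩
  push_cast at hm1 hm2
  have ht4 : ε * (n : ℝ) / 4 ≤ t := by linarith
  have h1 := GraphClass.prob_le_tailBound hA hne (K := n)
    (fun G _ => by have := numBlocks_le_card G; rw [Fintype.card_fin] at this; exact_mod_cast this)
    (t := t) (by omega)
    (P := fun R => ε * (n : ℝ) ≤ (diameter (blockForest R) : ℝ)) (fun G hG => by
      have : (2 * t + 2 : ℝ) < diameter (blockForest G) := by linarith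
      exact_mod_cast this)
  refine h1.trans ?_
  have hexp : -((t : ℝ) ^ 2 / (2 * n)) ≤ -(c * n) + -(c * n) := by
    have h2 : 2 * c * n * (2 * n) ≤ (t : ℝ) ^ 2 := by
      calc 2 * c * n * (2 * n) = (ε * (n : ℝ) / 4) ^ 2 := by rw [hc]; ring
        _ ≤ _ := by gcongr
    rw [← le_div_iff₀ (by positivity)] at h2
    linarith
  have hpol' : (n : ℝ) ^ 3 * (Real.exp 1 * ε) * Real.exp (-(c * n)) ≤ 1 := by
    rw [le_div_iff₀ (by positivity)] at hpol
    have h3 : 0 < c ^ 3 := by positivity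
    refine le_of_mul_le_mul_left ?_ h3
    calc _ = (c * n) ^ 3 * Real.exp (-(c * n)) * (Real.exp 1 * ε) := by ring
      _ ≤ _ := by rw [mul_one]; exact hpol
  calc (n : ℝ) ^ 2 * tailBound n t
      = (n : ℝ) ^ 2 * (Real.exp 1 * t) * Real.exp (-((t : ℝ) ^ 2 / (2 * n))) := by
        rw [tailBound]; ring
    _ ≤ (n : ℝ) ^ 2 * (Real.exp 1 * (ε * n)) * Real.exp (-(c * n) + -(c * n)) := by
        have : (t : ℝ) ≤ ε * n := by linarith
        gcongr
    _ = (n : ℝ) ^ 3 * (Real.exp 1 * ε) * Real.exp (-(c * n)) * Real.exp (-(c * n)) := by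
        rw [Real.exp_add]; ring
    _ ≤ 1 * Real.exp (-(c * n)) := by gcongr
    _ = _ := one_mul _

end BlockStable

end

theorem theorem2 :
    (∀ A : BlockStable.GraphClass, A.WeaklyBlockStable →
      A.Whp (fun n R => (BlockStable.diameter (BlockStable.blockForest R) : ℝ)
        ≤ 5 * Real.sqrt ((n : ℝ) * Real.log (n : ℝ)))) ∧
    (∀ ε : ℝ, 0 < ε → ∃ c : ℝ, 0 < c ∧ ∃ N : ℕ,
      ∀ A : BlockStable.GraphClass, A.WeaklyBlockStable →
        ∀ n : ℕ, N ≤ n → (A.on n).Nonempty →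
          A.prob n (fun R =>
            ε * (n : ℝ) ≤ (BlockStable.diameter (BlockStable.blockForest R) : ℝ))
            ≤ Real.exp (-(c * (n : ℝ)))) ∧
    (∀ A : BlockStable.GraphClass, A.WeaklyBlockStable →
      ∀ k : ℕ → ℝ,
        (∀ n : ℕ, 1 ≤ n → ∀ G ∈ A.on n, (BlockStable.numBlocks G : ℝ) ≤ k n) →
        Tendsto k A.sizes atTop →
        A.Whp (fun n R => (BlockStable.diameter (BlockStable.blockForest R) : ℝ)
          ≤ 5 * Real.sqrt (k n * Real.log (k n)))) := by
  refine ⟨fun A hA => ?_, fun ε hε => BlockStable.GraphClass.exists_prob_diameter_ge_le hε,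
    fun A hA k hk hlim => BlockStable.GraphClass.whp_diameter_le hA k hk hlim⟩
  refine BlockStable.GraphClass.whp_diameter_le hA (fun n => (n : ℝ)) (fun n _ G _ => ?_)
    (tendsto_natCast_atTop_atTop.mono_left inf_le_left)
  have := BlockStable.numBlocks_le_card G
  rw [Fintype.card_fin] at this
  exact_mod_cast this
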